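/- \textbf{Theorem 2 (Almost sure convergence).} Consider an $N$-player game in which player $i\in\{1,\dots,N\}$ chooses $a_i\in\mathcal A_i\subset\mathbb R^{d_i}$ ($d_i\ge 1$) and receives the utility $u_i(a)=u_i(a_i,a_{-i})$, $a\in\mathcal A=\prod_{i}\mathcal A_i$. Assume that for every $i$: $\mathcal A_i$ is compact and convex with nonempty interior; $u_i$ is continuous on $\mathcal A$; $u_i(\cdot,a_{-i})$ is concave and continuously differentiable on $\mathcal A_i$ for every $a_{-i}$; and the partial gradient $g_i(a)=\nabla_{a_i}u_i(a_i,a_{-i})$ satisfies $\|g_i(a)-g_i(a')\|\le L_i\|a-a'\|$ for all $a,a'\in\mathcal A$, for some constant $L_i$. Assume that the game is strictly monotone, that is, with $g=(g_1,\dots,g_N)$, $\langle g(a)-g(a'),a-a'\rangle<0$ for all $a\ne a'$ in $\mathcal A$. Let $c_i\in\mathbb R^{d_i}$ and $r_i>0$ be such that the ball of radius $r_i$ around $c_i$ is contained in $\mathcal A_i$. Let $\gamma_k>0$ and $\delta_k>0$ ($k\ge1$) satisfy $\gamma_k\to0$, $\delta_k\to0$, $(\delta_k)$ non-increasing, $\delta_1<\min_i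 r_i$, $\sum_k\gamma_k=\infty$, $\sum_k\gamma_k\delta_k<\infty$ and $\sum_k\gamma_k^2/\delta_k^2<\infty$. Let $a_1=(a_{i,1})_i$ be a (possibly random) initial profile in $\mathcal A$. Let $\lambda_{i,k}$ be uniformly distributed on the unit sphere of $\mathbb R^{d_i}$, and let $I_i^k\in\{0,1\}$ have $\mathbb P(I_i^k=1)=p_i>0$. Assume that for each $k$ the $2N$ random variables $\lambda_{1,k},\dots,\lambda_{N,k},I_1^k,\dots,I_N^k$ are mutually independent and that, jointly, they are independent of the $\sigma$-algebra generated by $a_1$ and by all $\lambda_{i,s},I_i^s$ with $s<k$. Algorithm OGD-lb with step sizes $\gamma_{i,k}=\gamma_k/p_i$ is the recursion, for all $i$ and $k\ge 1$, \[\hat a_{i,k}=a_{i,k}+\delta_k\bigl(\lambda_{i,k}-r_i^{-1}(a_{i,k}-c_i)\bigr),\qquad \hat g_{i,k}=\frac{d_i}{\delta_k}\,u_i(\hat a_k)\,\lambda_{i,k},\] \[a_{i,k+1}=\begin{cases}P_{\mathcal A_i}\bigl(a_{i,k}+\gamma_{i,k}\,\hat g_{i,k}\bigr)&\text{if } I_i^k=1,\\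 a_{i,k}&\text{if } I_i^k=0,\end{cases}\] where $P_{\mathcal A_i}$ is the Euclidean projection onto $\mathcal A_i$. Then the game has a unique Nash equilibrium, i.e. a unique $a^*\in\mathcal A$ with $u_i(a_i^*,a_{-i}^*)\ge u_i(a_i,a_{-i}^*)$ for all $i$ and all $a_i\in\mathcal A_i$, and the realized action sequence $\hat a_k$ converges to $a^*$ with probability $1$. -/

import Mathlib

open MeasureTheory ProbabilityTheory Filter Topology
open scoped RealInnerProductSpace

noncomputable section

namespace OGDlb

/-- Action profiles `(a_1, …, a_N)` with `a_i ∈ ℝ^{d_i}`. -/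
abbrev Profile {N : ℕ} (d : Fin N → ℕ) : Type := (i : Fin N) → EuclideanSpace ℝ (Fin (d i))

/-- An `N`-player utility maximization game: the action set `A_i ⊆ ℝ^{d_i}` and the utility `u_i`
of every player. Only the values of `u_i` on `∏ A_i` play a role. -/
structure Game {N : ℕ} (d : Fin N → ℕ) where
  /-- action sets -/
  A : (i : Fin N) → Set (EuclideanSpace ℝ (Fin (d i)))
  /-- utilities -/
  u : Fin N → Profile d → ℝ

namespace Game

variable {N : ℕ} {d : Fin N → ℕ} (G : Game d)

/-- The joint action space `∏ A_i`. -/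
def actions : Set (Profile d) := Set.univ.pi G.A

/-- The utility of player `i` as a function of its own action `x`, the others playing `a_{-i}`. -/
def ownUtility (i : Fin N) (a : Profile d) (x : EuclideanSpace ℝ (Fin (d i))) : ℝ :=
  G.u i (Function.update a i x)

/-- The partial gradient `g_i(a) = ∇_{a_i} u_i(a_i, a_{-i})`, taken relative to `A_i`
(at interior points of `A_i` it is the ordinary gradient). -/
def partialGrad (i : Fin N) (a : Profile d) : EuclideanSpace ℝ (Fin (d i)) :=
  gradientWithin (G.ownUtility i a) (G.A i) (a i)

/-- Basic assumptions on the game: convex compact action sets with nonempty interior; continuous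
utilities which are concave and continuously differentiable in the own action; partial gradients
which are Lipschitz in the whole profile for the Euclidean norm. -/
structure IsRegular : Prop where
  isClosed : ∀ i, IsClosed (G.A i)
  isCompact : ∀ i, IsCompact (G.A i)
  convex : ∀ i, Convex ℝ (G.A i)
  interior_nonempty : ∀ i, (interior (G.A i)).Nonempty
  continuousOn : ∀ i, ContinuousOn (G.u i) G.actions
  concave : ∀ i, ∀ a ∈ G.actions, ConcaveOn ℝ (G.A i) (G.ownUtility i a)
  contDiff : ∀ i, ∀ a ∈ G.actions, ContDiffOn ℝ 1 (G.ownUtility i a) (G.A i)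
  lipschitz : ∀ i, ∃ L : ℝ, ∀ a ∈ G.actions, ∀ a' ∈ G.actions,
    ‖G.partialGrad i a - G.partialGrad i a'‖ ≤ L * √(∑ j, ‖a j - a' j‖ ^ 2)

/-- Strict monotonicity: `⟨g(a) - g(a'), a - a'⟩ < 0` for all `a ≠ a'` in `∏ A_i`. -/
def IsStrictlyMonotone : Prop :=
  ∀ a ∈ G.actions, ∀ a' ∈ G.actions, a ≠ a' →
    ∑ i, ⟪G.partialGrad i a - G.partialGrad i a', a i - a' i⟫ < 0

/-- Nash equilibrium: no player gains by a unilateral deviation inside its action set. -/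
def IsNash (a : Profile d) : Prop :=
  a ∈ G.actions ∧ ∀ i, ∀ x ∈ G.A i, G.u i (Function.update a i x) ≤ G.u i a

end Game

/-- `x` is a point of `S` closest to `y`. -/
def IsClosestPoint {E : Type*} [NormedAddCommGroup E] (S : Set E) (y x : E) : Prop :=
  x ∈ S ∧ ∀ z ∈ S, ‖y - x‖ ≤ ‖y - z‖

open Classical in
/-- The projection `P_S(y) = argmin_{x ∈ S} ‖y - x‖`. -/
def proj {E : Type*} [NormedAddCommGroup E] (S : Set E) (y : E) : E :=
  if h : ∃ x, IsClosestPoint S y x then h.choose else y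

/-- On a nonempty compact set the projection is indeed a closest point. -/
theorem isClosestPoint_proj {E : Type*} [NormedAddCommGroup E] {S : Set E} (hS : IsCompact S)
    (hne : S.Nonempty) (y : E) : IsClosestPoint S y (proj S y) := by
  have h : ∃ x, IsClosestPoint S y x := by
    obtain ⟨x, hx, hmin⟩ := hS.exists_isMinOn hne
      (f := fun z => ‖y - z‖) (by fun_prop)
    exact ⟨x, hx, fun z hz => hmin hz⟩
  unfold proj
  rw [dif_pos h]
  exact h.choose_spec

/-- The unit sphere of `ℝ^m`. -/
abbrev UnitSphere (m : ℕ) : Type := Metric.sphere (0 : EuclideanSpace ℝ (Fin m)) 1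

/-- The uniform distribution on the unit sphere: normalized surface measure. -/
def uniformSphere (m : ℕ) : Measure (UnitSphere m) :=
  ((volume : Measure (EuclideanSpace ℝ (Fin m))).toSphere Set.univ)⁻¹ •
    (volume : Measure (EuclideanSpace ℝ (Fin m))).toSphere

/-- Parameters of the algorithm. Stages are numbered from `0`, so index `k` here is stage `k + 1`
in a numbering that starts from `1`. -/
structure Params {N : ℕ} (d : Fin N → ℕ) where
  /-- centers of the safety balls -/
  c : Profile d
  /-- radii of the safety balls -/
  r : Fin N → ℝ
  /-- query radii `δ_k` -/
  δ : ℕ → ℝ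
  /-- individual step sizes `γ_{i,k}` -/
  step : Fin N → ℕ → ℝ

section Algorithm

variable {N : ℕ} {d : Fin N → ℕ} (G : Game d) (P : Params d)

/-- The applied actions `â_{i,k} = a_{i,k} + δ_k θ_{i,k}`,
`θ_{i,k} = λ_{i,k} - r_i⁻¹ (a_{i,k} - c_i)`. -/
def applied (k : ℕ) (lam : (i : Fin N) → UnitSphere (d i)) (a : Profile d) : Profile d :=
  fun i => a i + P.δ k • ((lam i : EuclideanSpace ℝ (Fin (d i))) - (P.r i)⁻¹ • (a i - P.c i))

/-- The estimate `ĝ_{i,k} = (d_i / δ_k) u_i(â_k) λ_{i,k}`. -/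
def gradEst (k : ℕ) (lam : (i : Fin N) → UnitSphere (d i)) (a : Profile d) : Profile d :=
  fun i => ((d i / P.δ k) * G.u i (applied P k lam a)) • (lam i : EuclideanSpace ℝ (Fin (d i)))

/-- One round: player `i` performs a projected gradient step if its feedback is received
(`I i = true`) and keeps its action if the feedback is lost. -/
def update (k : ℕ) (lam : (i : Fin N) → UnitSphere (d i)) (I : Fin N → Bool) (a : Profile d) :
    Profile d :=
  fun i => if I i = true then proj (G.A i) (a i + P.step i k • gradEst G P k lam a i) else a i

variable {Ω : Type*} (a₁ : Ω → Profile d) (lam : (i : Fin N) → ℕ → Ω → UnitSphere (d i))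
  (I : Fin N → ℕ → Ω → Bool)

/-- The intended actions `a_k`, started at `a₁` and driven by the perturbations `λ_{i,k}` and the
feedback indicators `I_i^k`. -/
def intended : ℕ → Ω → Profile d
  | 0, ω => a₁ ω
  | k + 1, ω => update G P k (fun i => lam i k ω) (fun i => I i k ω) (intended k ω)

/-- The realized (applied) actions `â_k`. -/
def realized (k : ℕ) (ω : Ω) : Profile d :=
  applied P k (fun i => lam i k ω) (intended G P a₁ lam I k ω)

/-- The σ-algebra generated by the perturbations and indicators of stage `k`. -/
@[reducible] def stageSigma (k : ℕ) : MeasurableSpace Ω :=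
  ⨆ i, (MeasurableSpace.comap (lam i k) inferInstance ⊔ MeasurableSpace.comap (I i k) inferInstance)

/-- The history: the σ-algebra generated by the initial action and by the perturbations and
indicators of the stages before `k`. -/
@[reducible] def history (k : ℕ) : MeasurableSpace Ω :=
  MeasurableSpace.comap a₁ inferInstance ⊔ ⨆ s, ⨆ _ : s < k, stageSigma lam I s

/-- Probabilistic assumptions: `λ_{i,k}` is uniform on the unit sphere, `I_i^k` is Bernoulli with
`ℙ(I_i^k = 1) = p_i`; at each stage all the `λ_{i,k}`, `I_i^k` are mutually independent; and the
draws of a stage are independent of the history. In particular `(I_i^k)_k` is i.i.d. -/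
structure IsSampling [MeasurableSpace Ω] (μ : Measure Ω) (p : Fin N → ℝ) : Prop where
  measurable_init : Measurable a₁
  measurable_lam : ∀ i k, Measurable (lam i k)
  measurable_ind : ∀ i k, Measurable (I i k)
  law_lam : ∀ i k, μ.map (lam i k) = uniformSphere (d i)
  law_ind : ∀ i k, μ.real {ω | I i k ω = true} = p i
  indep_stage : ∀ k, iIndep (Sum.elim
    (fun i => MeasurableSpace.comap (lam i k) inferInstance)
    (fun i => MeasurableSpace.comap (I i k) inferInstance)) μ
  indep_history : ∀ k, Indep (stageSigma lam I k) (history a₁ lam I k) μ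

end Algorithm

end OGDlb

end

/-! Equilibrium. By concavity, Nash equilibria are exactly the solutions of the variational
inequality `⟨g(a*), a - a*⟩ ≤ 0` on the action space (`isNash_iff`). Since `-g` is monotone and
Lipschitz there, the inequality is solvable by an elementary argument: a fixed point for a strongly
monotone regularization, then compactness (`exists_variational_solution`). Strict monotonicity gives
uniqueness.

Convergence. The squared distance `V` of the intended action to `a*` is a Lyapunov function. As
projections are nonexpansive, one round changes `V` by at most a first-order increment plus
`O(γ²/δ²)` (`exists_descent_bound`). Given the history, the increment has mean at most `2γ⟨g(a), a -
a*⟩ + O(γδ)` (`exists_drift_bound`). Two facts enter here. A lost feedback costs a factor `p i`,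
which the step size `γ / p i` restores. The one-point estimator has bias `O(δ)`
(`exists_bias_bound`): expanding `u_i` in the player's own perturbation, the zeroth-order term is
independent of that perturbation and averages out, the linear term reproduces `g_i` because the
sphere has covariance `1/d_i` times the identity, and the `O(δ²)` remainder is divided by `δ`.

The compensated increments are martingale differences of size `O(γ/δ)`, square-summable, so their
sums converge almost surely. Along such a path the rest is deterministic
(`tendsto_zero_of_quasi_fejer`): `V` loses a non-summable `γ` times `-2⟨g(a), a - a*⟩`, which is
positive off `a*`, so `V → 0`. The realized action differs from the intended one by `O(δ)`.

Utilities are only continuous on the action space and may fail to be measurable globally; the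
probabilistic part is therefore run on a truncated game with the same trajectories. -/

noncomputable section

namespace OGDlb

/-! ### Euclidean projection onto compact convex sets -/

section Projection

variable {E : Type*} [NormedAddCommGroup E] [InnerProductSpace ℝ E] {S : Set E}

omit [InnerProductSpace ℝ E] in
theorem proj_mem (hS : IsCompact S) (hne : S.Nonempty) (y : E) : proj S y ∈ S :=
  (isClosestPoint_proj hS hne y).1

theorem inner_sub_proj_nonpos (hS : IsCompact S) (hne : S.Nonempty) (hc : Convex ℝ S) (y : E)
    {z : E} (hz : z ∈ S) : ⟪y - proj S y, z - proj S y⟫ ≤ 0 := by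
  obtain ⟨hmem, hmin⟩ := isClosestPoint_proj hS hne y
  refine (norm_eq_iInf_iff_real_inner_le_zero hc hmem).1 ?_ z hz
  have : Nonempty S := ⟨⟨_, hmem⟩⟩
  refine le_antisymm (le_ciInf fun w => hmin w w.2) ?_
  exact ciInf_le ⟨0, by rintro _ ⟨w, rfl⟩; exact norm_nonneg _⟩ (⟨proj S y, hmem⟩ : S)

/-- Adding the obtuse-angle inequalities at the two projections gives `‖p - q‖² ≤ ⟪x - y, p - q⟫`;
Cauchy-Schwarz does the rest. -/
theorem norm_proj_sub_proj_le (hS : IsCompact S) (hne : S.Nonempty) (hc : Convex ℝ S) (x y : E) :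
    ‖proj S x - proj S y‖ ≤ ‖x - y‖ := by
  have h1 := inner_sub_proj_nonpos hS hne hc x (proj_mem hS hne y)
  have h2 := inner_sub_proj_nonpos hS hne hc y (proj_mem hS hne x)
  set p := proj S x
  set q := proj S y
  have h3 : ‖p - q‖ * ‖p - q‖ ≤ ⟪x - y, p - q⟫ := by
    rw [← real_inner_self_eq_norm_mul_norm]
    have : ⟪x - y, p - q⟫ - ⟪p - q, p - q⟫ = - ⟪x - p, q - p⟫ - ⟪y - q, p - q⟫ := by
      simp only [inner_sub_left, inner_sub_right]; ring
    linarith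
  have h4 := real_inner_le_norm (x - y) (p - q)
  by_contra! hlt
  nlinarith [norm_nonneg (x - y), norm_nonneg (p - q)]

omit [InnerProductSpace ℝ E] in
theorem proj_eq_self (hS : IsCompact S) {x : E} (hx : x ∈ S) : proj S x = x := by
  have h := (isClosestPoint_proj hS ⟨x, hx⟩ x).2 x hx
  simp only [sub_self, norm_zero, norm_le_zero_iff] at h
  exact (sub_eq_zero.1 h).symm

theorem norm_proj_sub_le (hS : IsCompact S) (hc : Convex ℝ S) (y : E) {z : E} (hz : z ∈ S) :
    ‖proj S y - z‖ ≤ ‖y - z‖ := by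
  simpa [proj_eq_self hS hz] using norm_proj_sub_proj_le hS ⟨z, hz⟩ hc y z

theorem continuous_proj (hS : IsCompact S) (hne : S.Nonempty) (hc : Convex ℝ S) :
    Continuous (proj S) :=
  (LipschitzWith.of_dist_le_mul (K := 1) fun x y => by
    simpa [dist_eq_norm] using norm_proj_sub_proj_le hS hne hc x y).continuous

end Projection

/-! ### Solvability of monotone variational inequalities -/

section VariationalInequality

variable {E : Type*} [NormedAddCommGroup E] [InnerProductSpace ℝ E] {K : Set E} {F : E → E}

/-- Variational inequalities of strongly monotone Lipschitz operators are solvable. -/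
theorem exists_variational_solution_of_strongly_monotone (hK : IsCompact K) (hne : K.Nonempty)
    (hc : Convex ℝ K) {L ε : ℝ} (hL : 0 < L) (hε : 0 < ε)
    (hLip : ∀ x ∈ K, ∀ y ∈ K, ‖F x - F y‖ ≤ L * ‖x - y‖)
    (hmono : ∀ x ∈ K, ∀ y ∈ K, ε * ‖x - y‖ ^ 2 ≤ ⟪F x - F y, x - y⟫) :
    ∃ x ∈ K, ∀ y ∈ K, 0 ≤ ⟪F x, y - x⟫ := by
  -- This choice makes the quadratic term `τ²L²` equal to `τε`, half of the gain `2τε` from strong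
  -- monotonicity, so the forward step strictly shrinks distances.
  set τ := ε / L ^ 2 with hτ
  have hτ0 : 0 < τ := by positivity
  set T : E → E := fun x => proj K (x - τ • F x) with hT
  have hTK : ∀ x, T x ∈ K := fun x => proj_mem hK hne _
  have hcontr : ∀ x ∈ K, ∀ y ∈ K, x ≠ y → ‖T x - T y‖ < ‖x - y‖ := by
    intro x hx y hy hxy
    have hpos : 0 < ‖x - y‖ := norm_pos_iff.2 (sub_ne_zero.2 hxy)
    refine lt_of_le_of_lt (norm_proj_sub_proj_le hK hne hc _ _) ?_
    refine lt_of_pow_lt_pow_left₀ 2 hpos.le ?_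
    have e : x - τ • F x - (y - τ • F y) = (x - y) - τ • (F x - F y) := by
      rw [smul_sub]; abel
    rw [e, norm_sub_sq_real, inner_smul_right, norm_smul, Real.norm_of_nonneg hτ0.le,
      real_inner_comm]
    have h1 := hmono x hx y hy
    have h2 : ‖F x - F y‖ ^ 2 ≤ L ^ 2 * ‖x - y‖ ^ 2 := by
      rw [← mul_pow]; exact pow_le_pow_left₀ (norm_nonneg _) (hLip x hx y hy) 2
    have h3 : τ * (ε * ‖x - y‖ ^ 2) ≤ τ * ⟪F x - F y, x - y⟫ :=
      mul_le_mul_of_nonneg_left h1 hτ0.le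
    have h4 : (τ * ‖F x - F y‖) ^ 2 ≤ τ * (ε * ‖x - y‖ ^ 2) := by
      calc (τ * ‖F x - F y‖) ^ 2 = τ ^ 2 * ‖F x - F y‖ ^ 2 := by ring
        _ ≤ τ ^ 2 * (L ^ 2 * ‖x - y‖ ^ 2) := by gcongr
        _ = τ * (ε * ‖x - y‖ ^ 2) := by rw [hτ]; field_simp
    have h5 : 0 < τ * (ε * ‖x - y‖ ^ 2) := by positivity
    linarith
  have hFc : ContinuousOn F K :=
    (LipschitzOnWith.of_dist_le_mul (K := L.toNNReal) fun x hx y hy => by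
      simpa [dist_eq_norm, Real.coe_toNNReal _ hL.le] using hLip x hx y hy).continuousOn
  have hTc : ContinuousOn (fun x => ‖T x - x‖) K :=
    (((continuous_proj hK hne hc).comp_continuousOn
      (continuousOn_id.sub (hFc.const_smul τ))).sub continuousOn_id).norm
  -- On a compact set strict contraction suffices: a minimizer of `‖T x - x‖` must be fixed, since
  -- otherwise `T x` would have a smaller displacement.
  obtain ⟨x, hx, hmin⟩ := hK.exists_isMinOn hne hTc
  have hfix : T x = x := by
    by_contra hne'
    exact absurd (hmin (hTK x)) (not_le.2 (hcontr _ (hTK x) _ hx hne'))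
  refine ⟨x, hx, fun y hy => ?_⟩
  have h := inner_sub_proj_nonpos hK hne hc (x - τ • F x) hy
  rw [show proj K (x - τ • F x) = x from hfix, sub_sub_cancel_left, inner_neg_left,
    inner_smul_left] at h
  simp only [conj_trivial] at h
  by_contra! hlt
  nlinarith

/-- Variational inequalities of monotone Lipschitz operators on compact convex sets are
solvable. -/
theorem exists_variational_solution (hK : IsCompact K) (hne : K.Nonempty)
    (hc : Convex ℝ K) {L : ℝ} (hL : 0 ≤ L)
    (hLip : ∀ x ∈ K, ∀ y ∈ K, ‖F x - F y‖ ≤ L * ‖x - y‖)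
    (hmono : ∀ x ∈ K, ∀ y ∈ K, 0 ≤ ⟪F x - F y, x - y⟫) :
    ∃ x ∈ K, ∀ y ∈ K, 0 ≤ ⟪F x, y - x⟫ := by
  -- Tikhonov regularization: adding a vanishing multiple of the identity makes the operator
  -- strongly monotone; a cluster point of the solutions solves the original problem.
  have hreg : ∀ n : ℕ, ∃ x ∈ K, ∀ y ∈ K, 0 ≤ ⟪F x + (1 / ((n : ℝ) + 1)) • x, y - x⟫ := by
    intro n
    set ε : ℝ := 1 / ((n : ℝ) + 1)
    have hε : 0 < ε := by positivity
    refine exists_variational_solution_of_strongly_monotone (F := fun x => F x + ε • x)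
      (L := L + ε) hK hne hc (by positivity) hε ?_ ?_
    · intro x hx y hy
      calc ‖F x + ε • x - (F y + ε • y)‖ = ‖(F x - F y) + ε • (x - y)‖ := by
            rw [smul_sub]; congr 1; abel
        _ ≤ ‖F x - F y‖ + ‖ε • (x - y)‖ := norm_add_le _ _
        _ ≤ L * ‖x - y‖ + ε * ‖x - y‖ := by
            rw [norm_smul, Real.norm_of_nonneg hε.le]; gcongr; exact hLip x hx y hy
        _ = _ := by ring
    · intro x hx y hy
      have : F x + ε • x - (F y + ε • y) = (F x - F y) + ε • (x - y) := by
        rw [smul_sub]; abel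
      rw [this, inner_add_left, inner_smul_left, real_inner_self_eq_norm_sq]
      simpa using hmono x hx y hy
  choose x hxK hx using hreg
  obtain ⟨z, hz, φ, hφ, hlim⟩ := hK.tendsto_subseq hxK
  refine ⟨z, hz, fun y hy => ?_⟩
  have hFc : ContinuousOn F K :=
    (LipschitzOnWith.of_dist_le_mul (K := L.toNNReal) fun x hx y hy => by
      simpa [dist_eq_norm, Real.coe_toNNReal _ hL] using hLip x hx y hy).continuousOn
  have hF : Tendsto (fun n => F (x (φ n))) atTop (𝓝 (F z)) :=
    (hFc z hz).tendsto.comp (tendsto_nhdsWithin_iff.2 ⟨hlim, .of_forall fun n => hxK _⟩)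
  have hε : Tendsto (fun n => (1 / ((φ n : ℝ) + 1))) atTop (𝓝 0) :=
    tendsto_one_div_add_atTop_nhds_zero_nat.comp hφ.tendsto_atTop
  have := Tendsto.inner (𝕜 := ℝ) (hF.add (hε.smul hlim))
    ((tendsto_const_nhds (x := y)).sub hlim)
  rw [zero_smul, add_zero] at this
  exact ge_of_tendsto this (.of_forall fun n => hx (φ n) y hy)

end VariationalInequality

/-! ### Nash equilibria as solutions of a variational inequality -/

section Equilibrium

/-- The tangent plane of a concave function lies above its graph. -/
theorem _root_.ConcaveOn.le_add_of_hasFDerivWithinAt {E : Type*} [NormedAddCommGroup E]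
    [NormedSpace ℝ E] {s : Set E} {f : E → ℝ} {f' : E →L[ℝ] ℝ} {x y : E} (hf : ConcaveOn ℝ s f)
    (hf' : HasFDerivWithinAt f f' s x) (hx : x ∈ s) (hy : y ∈ s) : f y ≤ f x + f' (y - x) := by
  -- Restriction to the segment from `x` to `y` reduces the claim to the slope bound for concave
  -- functions of one variable.
  have hmaps : Set.MapsTo (AffineMap.lineMap (k := ℝ) x y) (Set.Icc (0 : ℝ) 1) s :=
    fun t ht => hf.1.lineMap_mem hx hy ht
  have hconc : ConcaveOn ℝ (Set.Icc (0 : ℝ) 1) (f ∘ AffineMap.lineMap (k := ℝ) x y) :=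
    (hf.comp_affineMap _).subset hmaps (convex_Icc 0 1)
  have hderiv : HasDerivWithinAt (f ∘ AffineMap.lineMap (k := ℝ) x y) (f' (y - x))
      (Set.Icc (0 : ℝ) 1) 0 := by
    refine HasFDerivWithinAt.comp_hasDerivWithinAt (t := s) (0 : ℝ) (by simpa using hf')
      AffineMap.hasDerivWithinAt_lineMap hmaps
  have h := hconc.slope_le_of_hasDerivWithinAt (by simp) (by simp) zero_lt_one hderiv
  simp only [slope_def_field, Function.comp_apply, AffineMap.lineMap_apply_one,
    AffineMap.lineMap_apply_zero] at h
  linarith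

variable {N : ℕ} {d : Fin N → ℕ} {G : Game d}

namespace Game

theorem update_mem_actions {a : Profile d} (ha : a ∈ G.actions) {i : Fin N}
    {x : EuclideanSpace ℝ (Fin (d i))} (hx : x ∈ G.A i) : Function.update a i x ∈ G.actions := by
  intro j _
  by_cases h : j = i
  · subst h; simpa using hx
  · simpa [h] using ha j trivial

theorem ownUtility_update (i : Fin N) (a : Profile d) (x : EuclideanSpace ℝ (Fin (d i))) :
    G.ownUtility i (Function.update a i x) = G.ownUtility i a := by
  funext y
  simp [ownUtility]

theorem ownUtility_self (i : Fin N) (a : Profile d) : G.ownUtility i a (a i) = G.u i a := by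
  simp [ownUtility]

namespace IsRegular

theorem isCompact_actions (hG : G.IsRegular) : IsCompact G.actions :=
  isCompact_univ_pi hG.isCompact

theorem convex_actions (hG : G.IsRegular) : Convex ℝ G.actions :=
  convex_pi fun i _ => hG.convex i

theorem isClosed_actions (hG : G.IsRegular) : IsClosed G.actions :=
  hG.isCompact_actions.isClosed

theorem nonempty (hG : G.IsRegular) (i : Fin N) : (G.A i).Nonempty :=
  (hG.interior_nonempty i).mono interior_subset

theorem hasGradientWithinAt (hG : G.IsRegular) {a : Profile d} (ha : a ∈ G.actions) (i : Fin N)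
    {x : EuclideanSpace ℝ (Fin (d i))} (hx : x ∈ G.A i) :
    HasGradientWithinAt (G.ownUtility i a) (G.partialGrad i (Function.update a i x)) (G.A i) x := by
  have h := ((hG.contDiff i a ha).differentiableOn one_ne_zero x hx).hasGradientWithinAt
  simpa [partialGrad, ownUtility_update] using h

theorem hasGradientWithinAt_self (hG : G.IsRegular) {a : Profile d} (ha : a ∈ G.actions)
    (i : Fin N) : HasGradientWithinAt (G.ownUtility i a) (G.partialGrad i a) (G.A i) (a i) := by
  simpa using hG.hasGradientWithinAt ha i (ha i trivial)

/-- First-order Taylor estimate of a utility in the own action. -/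
theorem abs_sub_sub_inner_le (hG : G.IsRegular) {a : Profile d} (ha : a ∈ G.actions) (i : Fin N)
    {x y v : EuclideanSpace ℝ (Fin (d i))} (hx : x ∈ G.A i) (hy : y ∈ G.A i) {C : ℝ}
    (hC : ∀ z ∈ segment ℝ x y, ‖G.partialGrad i (Function.update a i z) - v‖ ≤ C) :
    |G.u i (Function.update a i y) - G.u i (Function.update a i x) - ⟪v, y - x⟫| ≤
      C * ‖y - x‖ := by
  have hseg : segment ℝ x y ⊆ G.A i := (hG.convex i).segment_subset hx hy
  have h := Convex.norm_image_sub_le_of_norm_hasFDerivWithin_le' (s := segment ℝ x y)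
    (f := G.ownUtility i a)
    (f' := fun z => InnerProductSpace.toDual ℝ _ (G.partialGrad i (Function.update a i z)))
    (φ := InnerProductSpace.toDual ℝ _ v) (C := C)
    (fun z hz => (hG.hasGradientWithinAt ha i (hseg hz)).hasFDerivWithinAt.mono hseg)
    (fun z hz => by
      rw [← map_sub, LinearIsometryEquiv.norm_map]
      exact hC z hz)
    (convex_segment x y) (left_mem_segment ℝ x y) (right_mem_segment ℝ x y)
  simpa [ownUtility] using h

theorem le_add_inner (hG : G.IsRegular) {a : Profile d} (ha : a ∈ G.actions) (i : Fin N)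
    {x : EuclideanSpace ℝ (Fin (d i))} (hx : x ∈ G.A i) :
    G.u i (Function.update a i x) ≤ G.u i a + ⟪G.partialGrad i a, x - a i⟫ := by
  have h := (hG.concave i a ha).le_add_of_hasFDerivWithinAt
    (hG.hasGradientWithinAt_self ha i).hasFDerivWithinAt (ha i trivial) hx
  rw [ownUtility_self] at h
  simpa [ownUtility] using h

/-- The Lipschitz constants can be taken nonnegative and independent of the player. -/
theorem exists_lipschitz (hG : G.IsRegular) : ∃ L : ℝ, 0 ≤ L ∧ ∀ i, ∀ a ∈ G.actions,
    ∀ a' ∈ G.actions, ‖G.partialGrad i a - G.partialGrad i a'‖ ≤ L * √(∑ j, ‖a j - a' j‖ ^ 2) := by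
  choose L hL using hG.lipschitz
  refine ⟨∑ i, |L i|, Finset.sum_nonneg fun i _ => abs_nonneg _, fun i a ha a' ha' => ?_⟩
  refine (hL i a ha a' ha').trans ?_
  gcongr
  exact (le_abs_self _).trans
    (Finset.single_le_sum (f := fun i => |L i|) (fun i _ => abs_nonneg _) (Finset.mem_univ i))

theorem continuousOn_partialGrad (hG : G.IsRegular) (i : Fin N) :
    ContinuousOn (G.partialGrad i) G.actions := by
  obtain ⟨L, hL0, hL⟩ := hG.exists_lipschitz
  intro a ha
  rw [ContinuousWithinAt, tendsto_iff_norm_sub_tendsto_zero]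
  refine squeeze_zero' (.of_forall fun _ => norm_nonneg _)
    (eventually_mem_nhdsWithin.mono fun b hb => hL i b hb a ha) ?_
  have hc : Continuous fun b : Profile d => L * √(∑ j, ‖b j - a j‖ ^ 2) := by fun_prop
  have := (hc.tendsto a).mono_left (nhdsWithin_le_nhds (s := G.actions))
  simpa using this

/-- Nash equilibria are the solutions of the variational inequality of the game. -/
theorem isNash_iff (hG : G.IsRegular) {a : Profile d} : G.IsNash a ↔
    a ∈ G.actions ∧ ∀ i, ∀ x ∈ G.A i, ⟪G.partialGrad i a, x - a i⟫ ≤ 0 := by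
  refine and_congr_right fun ha => forall_congr' fun i => ⟨fun h x hx => ?_, fun h x hx => ?_⟩
  · have hmax : IsMaxOn (G.ownUtility i a) (G.A i) (a i) := fun y hy => by
      simpa [ownUtility] using h y hy
    simpa using hmax.localize.hasFDerivWithinAt_nonpos
      (hG.hasGradientWithinAt_self ha i).hasFDerivWithinAt
      (sub_mem_posTangentConeAt_of_segment_subset
        ((hG.convex i).segment_subset (ha i trivial) hx))
  · linarith [hG.le_add_inner ha i hx, h x hx]

theorem isNash_unique (hG : G.IsRegular) (hmono : G.IsStrictlyMonotone) {a b : Profile d}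
    (ha : G.IsNash a) (hb : G.IsNash b) : a = b := by
  obtain ⟨ha, ha'⟩ := hG.isNash_iff.1 ha
  obtain ⟨hb, hb'⟩ := hG.isNash_iff.1 hb
  by_contra hab
  refine absurd (hmono a ha b hb hab) (not_lt.2 (Finset.sum_nonneg fun i _ => ?_))
  have h1 := ha' i (b i) (hb i trivial)
  have h2 := hb' i (a i) (ha i trivial)
  rw [← neg_sub, inner_neg_right] at h1
  rw [inner_sub_left]
  linarith

theorem sum_inner_nonpos (hG : G.IsRegular) {a b : Profile d} (ha : G.IsNash a)
    (hb : b ∈ G.actions) : ∑ i, ⟪G.partialGrad i a, b i - a i⟫ ≤ 0 :=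
  Finset.sum_nonpos fun i _ => (hG.isNash_iff.1 ha).2 i (b i) (hb i trivial)

theorem exists_isNash (hG : G.IsRegular) (hmono : G.IsStrictlyMonotone) : ∃ a, G.IsNash a := by
  obtain ⟨L, hL0, hL⟩ := hG.exists_lipschitz
  -- `Profile d` carries the sup norm; the variational inequality needs an inner product, so the
  -- action space is moved to the `L²` product.
  set K : Set (PiLp 2 fun i => EuclideanSpace ℝ (Fin (d i))) := WithLp.ofLp ⁻¹' G.actions with hKdef
  have hKimg : K = WithLp.toLp 2 '' G.actions := by
    ext x
    exact ⟨fun hx => ⟨x.ofLp, hx, rfl⟩, by rintro ⟨y, hy, rfl⟩; exact hy⟩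
  have hK : IsCompact K := by
    rw [hKimg]
    exact hG.isCompact_actions.image (PiLp.continuous_toLp 2 _)
  have hne : K.Nonempty := ⟨WithLp.toLp 2 fun i => (hG.nonempty i).some, fun i _ =>
    (hG.nonempty i).some_mem⟩
  have hc : Convex ℝ K := fun x hx y hy s t hs ht hst => hG.convex_actions hx hy hs ht hst
  obtain ⟨x, hx, hsol⟩ := exists_variational_solution (K := K) (L := √(∑ _i : Fin N, L ^ 2))
    (F := fun x => WithLp.toLp 2 fun i => -G.partialGrad i x.ofLp) hK hne hc (Real.sqrt_nonneg _)
    (fun x hx y hy => by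
      rw [PiLp.norm_eq_of_L2, PiLp.norm_eq_of_L2, ← Real.sqrt_mul (by positivity), Finset.sum_mul]
      refine Real.sqrt_le_sqrt (Finset.sum_le_sum fun i _ => ?_)
      have h := hL i x.ofLp hx y.ofLp hy
      have hs : 0 ≤ ∑ j, ‖x.ofLp j - y.ofLp j‖ ^ 2 := by positivity
      have h2 := pow_le_pow_left₀ (norm_nonneg _) h 2
      rw [mul_pow, Real.sq_sqrt hs] at h2
      refine le_trans (le_of_eq ?_) h2
      congr 1
      rw [← norm_neg]
      congr 1
      simp [neg_add_eq_sub])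
    (fun x hx y hy => by
      rw [PiLp.inner_apply]
      by_cases hxy : x.ofLp = y.ofLp
      · simp [hxy]
      · have h := hmono x.ofLp hx y.ofLp hy hxy
        rw [← neg_pos, ← Finset.sum_neg_distrib] at h
        refine h.le.trans (le_of_eq (Finset.sum_congr rfl fun i _ => ?_))
        rw [← inner_neg_left]
        congr 1
        simp [neg_add_eq_sub])
  refine ⟨x.ofLp, hG.isNash_iff.2 ⟨hx, fun i z hz => ?_⟩⟩
  -- Testing against a unilateral deviation isolates the inequality of player `i`.
  have h := hsol (WithLp.toLp 2 (Function.update x.ofLp i z)) (update_mem_actions hx hz)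
  rw [PiLp.inner_apply, Finset.sum_eq_single i] at h
  · simpa using h
  · intro j _ hj
    simp [hj]
  · simp

end IsRegular

end Game

end Equilibrium

/-! ### First and second moments of the uniform distribution on the sphere -/

section UniformSphere

open scoped Pointwise

variable {m : ℕ}

/-- The action of a linear isometry on the unit sphere. -/
def sphereMap (U : EuclideanSpace ℝ (Fin m) ≃ₗᵢ[ℝ] EuclideanSpace ℝ (Fin m)) (x : UnitSphere m) :
    UnitSphere m :=
  ⟨U x, by simp⟩

theorem measurable_sphereMap (U : EuclideanSpace ℝ (Fin m) ≃ₗᵢ[ℝ] EuclideanSpace ℝ (Fin m)) :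
    Measurable (sphereMap U) :=
  (Continuous.subtype_mk (U.continuous.comp continuous_subtype_val) _).measurable

/-- Surface measure is a multiple of the volume of the cone over a set; an isometry commutes with
forming cones and preserves volume. -/
theorem toSphere_preimage_sphereMap
    (U : EuclideanSpace ℝ (Fin m) ≃ₗᵢ[ℝ] EuclideanSpace ℝ (Fin m)) {s : Set (UnitSphere m)}
    (hs : MeasurableSet s) :
    (volume : Measure (EuclideanSpace ℝ (Fin m))).toSphere (sphereMap U ⁻¹' s) =
      (volume : Measure (EuclideanSpace ℝ (Fin m))).toSphere s := by
  rw [Measure.toSphere_apply' _ hs, Measure.toSphere_apply' _ (measurable_sphereMap U hs)]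
  congr 1
  have hset : (Set.Ioo (0 : ℝ) 1 • (Subtype.val '' (sphereMap U ⁻¹' s)) :
      Set (EuclideanSpace ℝ (Fin m))) = U.toMeasurableEquiv ⁻¹' (Set.Ioo (0 : ℝ) 1 • (Subtype.val '' s)) := by
    ext x
    simp only [Set.mem_smul, Set.mem_image, Set.mem_preimage]
    constructor
    · rintro ⟨t, ht, _, ⟨y, hy, rfl⟩, rfl⟩
      exact ⟨t, ht, _, ⟨sphereMap U y, hy, rfl⟩, by simp [sphereMap]⟩
    · rintro ⟨t, ht, _, ⟨y, hy, rfl⟩, hx⟩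
      refine ⟨t, ht, _, ⟨sphereMap U.symm y, ?_, rfl⟩, ?_⟩
      · have : sphereMap U (sphereMap U.symm y) = y := by
          ext1; simp [sphereMap]
        rwa [this]
      · apply U.injective
        simpa [sphereMap] using hx
  rw [hset]
  exact MeasurePreserving.measure_preimage_equiv (f := U.toMeasurableEquiv) U.measurePreserving _

theorem map_sphereMap_uniformSphere
    (U : EuclideanSpace ℝ (Fin m) ≃ₗᵢ[ℝ] EuclideanSpace ℝ (Fin m)) :
    (uniformSphere m).map (sphereMap U) = uniformSphere m := by
  ext s hs
  rw [Measure.map_apply (measurable_sphereMap U) hs]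
  simp only [uniformSphere, Measure.smul_apply, toSphere_preimage_sphereMap U hs]

theorem integral_comp_sphereMap
    (U : EuclideanSpace ℝ (Fin m) ≃ₗᵢ[ℝ] EuclideanSpace ℝ (Fin m)) {f : UnitSphere m → ℝ}
    (hf : Measurable f) :
    ∫ x, f (sphereMap U x) ∂uniformSphere m = ∫ x, f x ∂uniformSphere m := by
  conv_rhs => rw [← map_sphereMap_uniformSphere U]
  exact (integral_map (measurable_sphereMap U).aemeasurable hf.aestronglyMeasurable).symm

theorem measurable_inner_sphere (v : EuclideanSpace ℝ (Fin m)) :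
    Measurable fun x : UnitSphere m => ⟪v, (x : EuclideanSpace ℝ (Fin m))⟫ :=
  measurable_const.inner measurable_subtype_coe

/-- The antipodal map preserves the measure and flips the sign of the integrand. -/
theorem integral_inner_uniformSphere (v : EuclideanSpace ℝ (Fin m)) :
    ∫ x : UnitSphere m, ⟪v, (x : EuclideanSpace ℝ (Fin m))⟫ ∂uniformSphere m = 0 := by
  have h := integral_comp_sphereMap (LinearIsometryEquiv.neg ℝ) (measurable_inner_sphere v)
  simp only [sphereMap, LinearIsometryEquiv.coe_neg, inner_neg_right, integral_neg] at h
  linarith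

theorem abs_inner_sphere_le (v : EuclideanSpace ℝ (Fin m)) (x : UnitSphere m) :
    |⟪v, (x : EuclideanSpace ℝ (Fin m))⟫| ≤ ‖v‖ := by
  simpa using abs_real_inner_le_norm v (x : EuclideanSpace ℝ (Fin m))

theorem integrable_inner_mul_inner (μ : Measure (UnitSphere m)) [IsFiniteMeasure μ]
    (v w : EuclideanSpace ℝ (Fin m)) :
    Integrable (fun x : UnitSphere m => ⟪v, (x : EuclideanSpace ℝ (Fin m))⟫ *
      ⟪w, (x : EuclideanSpace ℝ (Fin m))⟫) μ := by
  refine Integrable.of_bound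
    ((measurable_inner_sphere v).mul (measurable_inner_sphere w)).aestronglyMeasurable
    (‖v‖ * ‖w‖) (.of_forall fun x => ?_)
  rw [norm_mul]
  exact mul_le_mul (abs_inner_sphere_le v x) (abs_inner_sphere_le w x) (norm_nonneg _)
    (norm_nonneg _)

/-- The reflection in the hyperplane orthogonal to `v - w` carries `v` to `w`. -/
theorem integral_inner_sq_eq_of_norm_eq {v w : EuclideanSpace ℝ (Fin m)} (h : ‖v‖ = ‖w‖) :
    ∫ x : UnitSphere m, ⟪v, (x : EuclideanSpace ℝ (Fin m))⟫ ^ 2 ∂uniformSphere m =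
      ∫ x : UnitSphere m, ⟪w, (x : EuclideanSpace ℝ (Fin m))⟫ ^ 2 ∂uniformSphere m := by
  set U := (ℝ ∙ (v - w))ᗮ.reflection
  have hU : U v = w := Submodule.reflection_sub h
  rw [← integral_comp_sphereMap U ((measurable_inner_sphere w).pow_const 2)]
  refine integral_congr_ae (.of_forall fun x => ?_)
  change ⟪v, (x : EuclideanSpace ℝ (Fin m))⟫ ^ 2 = ⟪w, U x⟫ ^ 2
  rw [← hU, U.inner_map_map]

/-- By rotation invariance `v` can be replaced by `‖v‖` times any coordinate vector; the squares of
the `m` coordinates sum to `1` on the sphere. -/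
theorem integral_inner_sq_uniformSphere [IsProbabilityMeasure (uniformSphere m)]
    (v : EuclideanSpace ℝ (Fin m)) :
    m * ∫ x : UnitSphere m, ⟪v, (x : EuclideanSpace ℝ (Fin m))⟫ ^ 2 ∂uniformSphere m =
      ‖v‖ ^ 2 := by
  have hi : ∀ w : EuclideanSpace ℝ (Fin m), Integrable (fun x : UnitSphere m =>
      ⟪w, (x : EuclideanSpace ℝ (Fin m))⟫ ^ 2) (uniformSphere m) := fun w => by
    simpa only [sq] using integrable_inner_mul_inner (uniformSphere m) w w
  have hsum : ∑ i : Fin m, ∫ x : UnitSphere m,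
      ⟪‖v‖ • EuclideanSpace.single i (1 : ℝ), (x : EuclideanSpace ℝ (Fin m))⟫ ^ 2
        ∂uniformSphere m = ‖v‖ ^ 2 := by
    rw [← integral_finsetSum _ fun i _ => hi _]
    have : ∀ x : UnitSphere m, ∑ i : Fin m,
        ⟪‖v‖ • EuclideanSpace.single i (1 : ℝ), (x : EuclideanSpace ℝ (Fin m))⟫ ^ 2 =
          ‖v‖ ^ 2 := by
      intro x
      have hx : ∑ i : Fin m, (x : EuclideanSpace ℝ (Fin m)) i ^ 2 = 1 := by
        have := EuclideanSpace.real_norm_sq_eq (x : EuclideanSpace ℝ (Fin m))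
        simpa using this.symm
      simp only [inner_smul_left, EuclideanSpace.inner_single_left, mul_pow, conj_trivial,
        map_one, one_mul]
      rw [← Finset.mul_sum, hx, mul_one]
    simp only [this]
    simp
  rw [← hsum, Finset.sum_congr rfl fun i _ => integral_inner_sq_eq_of_norm_eq (w := v) ?_]
  · simp
  · simp [norm_smul]

/-- The covariance of the uniform distribution on the sphere is the identity divided by the
dimension. -/
theorem integral_inner_mul_inner_uniformSphere [IsProbabilityMeasure (uniformSphere m)]
    (v w : EuclideanSpace ℝ (Fin m)) :
    m * ∫ x : UnitSphere m, ⟪v, (x : EuclideanSpace ℝ (Fin m))⟫ *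
      ⟪w, (x : EuclideanSpace ℝ (Fin m))⟫ ∂uniformSphere m = ⟪v, w⟫ := by
  have hi : ∀ w : EuclideanSpace ℝ (Fin m), Integrable (fun x : UnitSphere m =>
      ⟪w, (x : EuclideanSpace ℝ (Fin m))⟫ ^ 2) (uniformSphere m) := fun w => by
    simpa only [sq] using integrable_inner_mul_inner (uniformSphere m) w w
  -- Polarization.
  have h : ∫ x : UnitSphere m, ⟪v, (x : EuclideanSpace ℝ (Fin m))⟫ *
      ⟪w, (x : EuclideanSpace ℝ (Fin m))⟫ ∂uniformSphere m =
      (∫ x : UnitSphere m, ⟪v + w, (x : EuclideanSpace ℝ (Fin m))⟫ ^ 2 ∂uniformSphere m -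
      ∫ x : UnitSphere m, ⟪v - w, (x : EuclideanSpace ℝ (Fin m))⟫ ^ 2 ∂uniformSphere m) / 4 := by
    rw [← integral_sub (hi _) (hi _), ← integral_div]
    refine integral_congr_ae (.of_forall fun x => ?_)
    simp only [inner_add_left, inner_sub_left]
    ring
  rw [h, mul_div_assoc', mul_sub, integral_inner_sq_uniformSphere,
    integral_inner_sq_uniformSphere, norm_add_sq_real, norm_sub_sq_real]
  ring

end UniformSphere

/-! ### The one-point gradient estimator: feasibility, expansion and bias -/

section Estimator

variable {N : ℕ} {d : Fin N → ℕ} {G : Game d} {P : Params d}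

namespace Game.IsRegular

theorem exists_diameter_bound (hG : G.IsRegular) : ∃ R : ℝ, 0 ≤ R ∧
    ∀ a ∈ G.actions, ∀ b ∈ G.actions, ∀ i, ‖a i - b i‖ ≤ R := by
  obtain ⟨R, hR⟩ := Metric.isBounded_iff.1 hG.isCompact_actions.isBounded
  refine ⟨max R 0, le_max_right _ _, fun a ha b hb i => ?_⟩
  rw [← dist_eq_norm]
  exact (dist_le_pi_dist a b i).trans ((hR ha hb).trans (le_max_left _ _))

theorem exists_utility_bound (hG : G.IsRegular) : ∃ B : ℝ, 0 ≤ B ∧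
    ∀ i, ∀ a ∈ G.actions, |G.u i a| ≤ B := by
  choose B hB using fun i => hG.isCompact_actions.exists_bound_of_continuousOn (hG.continuousOn i)
  refine ⟨∑ i, |B i|, Finset.sum_nonneg fun i _ => abs_nonneg _, fun i a ha => ?_⟩
  exact (hB i a ha).trans ((le_abs_self _).trans
    (Finset.single_le_sum (f := fun i => |B i|) (fun i _ => abs_nonneg _) (Finset.mem_univ i)))

end Game.IsRegular

/-- The parameters are admissible at stage `k`: the safety balls lie in the action sets and the
query radius is smaller than their radii. -/
structure Params.IsSafe (P : Params d) (G : Game d) (k : ℕ) : Prop where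
  closedBall_subset : ∀ i, Metric.closedBall (P.c i) (P.r i) ⊆ G.A i
  pos : 0 < P.δ k
  lt_radius : ∀ i, P.δ k < P.r i

theorem Params.IsSafe.center_mem {k : ℕ} (hP : P.IsSafe G k) : P.c ∈ G.actions := fun i _ =>
  hP.closedBall_subset i (Metric.mem_closedBall_self (hP.pos.trans (hP.lt_radius i)).le)

/-- The point is the convex combination of `a i` and `c i + r i • v` with weight `δ / r i` on the
latter. Allowing `‖v‖ ≤ 1` covers the centre `v = 0` as well as the sphere. -/
theorem Params.IsSafe.perturb_mem (hG : G.IsRegular) {k : ℕ} (hP : P.IsSafe G k) {a : Profile d}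
    (ha : a ∈ G.actions) (i : Fin N) {v : EuclideanSpace ℝ (Fin (d i))} (hv : ‖v‖ ≤ 1) :
    a i + P.δ k • (v - (P.r i)⁻¹ • (a i - P.c i)) ∈ G.A i := by
  have hr : 0 < P.r i := hP.pos.trans (hP.lt_radius i)
  have hmem : P.c i + P.r i • v ∈ G.A i := hP.closedBall_subset i <| by
    rw [Metric.mem_closedBall, dist_eq_norm, add_sub_cancel_left, norm_smul,
      Real.norm_of_nonneg hr.le]
    exact mul_le_of_le_one_right hr.le hv
  have ht : P.δ k / P.r i ≤ 1 := (div_le_one hr).2 (hP.lt_radius i).le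
  have ht0 : 0 ≤ P.δ k / P.r i := div_nonneg hP.pos.le hr.le
  have h := hG.convex i (ha i trivial) hmem (sub_nonneg.2 ht) ht0 (sub_add_cancel _ _)
  convert h using 1
  have e : P.δ k = P.δ k / P.r i * P.r i := by field_simp
  rw [smul_sub, smul_smul, smul_add (P.δ k / P.r i), smul_smul (P.δ k / P.r i), ← e,
    ← div_eq_mul_inv, sub_smul, one_smul, smul_sub]
  abel

theorem Params.IsSafe.applied_mem (hG : G.IsRegular) {k : ℕ} (hP : P.IsSafe G k) {a : Profile d}
    (ha : a ∈ G.actions) (lam : (i : Fin N) → UnitSphere (d i)) : applied P k lam a ∈ G.actions :=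
  fun i _ => hP.perturb_mem hG ha i (by simp)

theorem update_mem_actions (hG : G.IsRegular) {k : ℕ} (lam : (i : Fin N) → UnitSphere (d i))
    (I : Fin N → Bool) {a : Profile d} (ha : a ∈ G.actions) : update G P k lam I a ∈ G.actions := by
  intro i _
  simp only [update]
  split_ifs
  · exact proj_mem (hG.isCompact i) (hG.nonempty i) _
  · exact ha i trivial

theorem exists_displacement_bound (hG : G.IsRegular) (P : Params d) : ∃ K : ℝ, 0 ≤ K ∧
    ∀ k, P.IsSafe G k → ∀ a ∈ G.actions, ∀ i, ∀ v : EuclideanSpace ℝ (Fin (d i)), ‖v‖ ≤ 1 →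
      ‖P.δ k • (v - (P.r i)⁻¹ • (a i - P.c i))‖ ≤ P.δ k * K := by
  obtain ⟨R, hR0, hR⟩ := hG.exists_diameter_bound
  refine ⟨1 + ∑ i, |P.r i|⁻¹ * R, by positivity, fun k hP a ha i v hv => ?_⟩
  rw [norm_smul, Real.norm_of_nonneg hP.pos.le]
  refine mul_le_mul_of_nonneg_left ((norm_sub_le _ _).trans (add_le_add hv ?_)) hP.pos.le
  rw [norm_smul, norm_inv, Real.norm_eq_abs]
  calc |P.r i|⁻¹ * ‖a i - P.c i‖ ≤ |P.r i|⁻¹ * R := by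
        gcongr; exact hR a ha _ hP.center_mem i
    _ ≤ _ := Finset.single_le_sum (f := fun i => |P.r i|⁻¹ * R) (fun j _ => by positivity)
        (Finset.mem_univ i)

/-- Expansion of the utility of the applied profile in the own perturbation. -/
theorem exists_expansion_bound (hG : G.IsRegular) (P : Params d) : ∃ C : ℝ, 0 ≤ C ∧
    ∀ k, P.IsSafe G k → ∀ a ∈ G.actions, ∀ (lam : (i : Fin N) → UnitSphere (d i)) (i : Fin N),
      |G.u i (applied P k lam a) -
        G.u i (Function.update (applied P k lam a) i
          (a i + P.δ k • (0 - (P.r i)⁻¹ • (a i - P.c i)))) -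
        P.δ k * ⟪G.partialGrad i a, (lam i : EuclideanSpace ℝ (Fin (d i)))⟫| ≤
        C * P.δ k ^ 2 := by
  obtain ⟨L, hL0, hL⟩ := hG.exists_lipschitz
  obtain ⟨K, hK0, hK⟩ := exists_displacement_bound hG P
  refine ⟨L * (√N * K), by positivity, fun k hP a ha lam i => ?_⟩
  have hb := hP.applied_mem hG ha lam
  set b := applied P k lam a with hbdef
  -- The own action with its perturbation removed: the profile with `x` in slot `i` does not depend
  -- on `lam i`.
  set x := a i + P.δ k • (0 - (P.r i)⁻¹ • (a i - P.c i)) with hx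
  have hyx : b i - x = P.δ k • (lam i : EuclideanSpace ℝ (Fin (d i))) := by
    simp only [hbdef, hx, applied, smul_sub, smul_zero]
    abel
  -- Every profile on the segment is within `√N δ K` of `a`, so the linear term may use the gradient
  -- at `a` itself.
  have hdist : ∀ z ∈ segment ℝ x (b i), ‖G.partialGrad i (Function.update b i z) -
      G.partialGrad i a‖ ≤ L * (√N * (P.δ k * K)) := by
    intro z hz
    have hzA : z ∈ G.A i := (hG.convex i).segment_subset
      (hP.perturb_mem hG ha i (by simp)) (hb i trivial) hz
    refine (hL i _ (Game.update_mem_actions hb hzA) a ha).trans ?_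
    refine mul_le_mul_of_nonneg_left ?_ hL0
    have hcoord : ∀ j, ‖Function.update b i z j - a j‖ ^ 2 ≤ (P.δ k * K) ^ 2 := by
      intro j
      refine pow_le_pow_left₀ (norm_nonneg _) ?_ 2
      by_cases hj : j = i
      · subst hj
        -- Points of the segment are perturbations of `a j` by `s • lam j` with `0 ≤ s ≤ 1`, so the
        -- displacement bound applies to them.
        rw [segment_eq_image'] at hz
        obtain ⟨s, ⟨hs0, hs1⟩, rfl⟩ := hz
        have h := hK k hP a ha j (s • (lam j : EuclideanSpace ℝ (Fin (d j))))
          (by rw [norm_smul, Real.norm_of_nonneg hs0]; simpa using hs1)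
        refine le_trans (le_of_eq ?_) h
        congr 1
        rw [Function.update_self, hyx, hx]
        simp only [smul_sub, smul_zero, smul_smul, mul_comm s]
        abel
      · rw [Function.update_of_ne hj]
        simpa [hbdef, applied] using
          hK k hP a ha j (lam j : EuclideanSpace ℝ (Fin (d j))) (by simp)
    calc √(∑ j, ‖Function.update b i z j - a j‖ ^ 2) ≤ √(∑ _j : Fin N, (P.δ k * K) ^ 2) :=
          Real.sqrt_le_sqrt (Finset.sum_le_sum fun j _ => hcoord j)
      _ = √N * (P.δ k * K) := by
          rw [Finset.sum_const, Finset.card_univ, Fintype.card_fin, nsmul_eq_mul,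
            Real.sqrt_mul (Nat.cast_nonneg _), Real.sqrt_sq (mul_nonneg hP.pos.le hK0)]
  have h := hG.abs_sub_sub_inner_le hb i (hP.perturb_mem hG ha i (by simp)) (hb i trivial) hdist
  rw [Function.update_eq_self, hyx, inner_smul_right, norm_smul, Real.norm_of_nonneg hP.pos.le] at h
  refine h.trans (le_of_eq ?_)
  simp
  ring

section Measurability

variable {Ω : Type*} [MeasurableSpace Ω] {X : (i : Fin N) → Ω → UnitSphere (d i)}
  {J : Fin N → Ω → Bool} {A : Ω → Profile d}

theorem measurable_applied_apply (k : ℕ) (hA : Measurable A) {i : Fin N} (hX : Measurable (X i)) :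
    Measurable fun ω => applied P k (fun j => X j ω) (A ω) i := by
  have hAi : Measurable fun ω => A ω i := (measurable_pi_apply i).comp hA
  have hXi : Measurable fun ω => (X i ω : EuclideanSpace ℝ (Fin (d i))) :=
    measurable_subtype_coe.comp hX
  have h : Measurable fun ω => A ω i + P.δ k •
      ((X i ω : EuclideanSpace ℝ (Fin (d i))) - (P.r i)⁻¹ • (A ω i - P.c i)) := by fun_prop
  exact h

theorem measurable_applied (k : ℕ) (hA : Measurable A) (hX : ∀ i, Measurable (X i)) :
    Measurable fun ω => applied P k (fun j => X j ω) (A ω) :=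
  measurable_pi_lambda _ fun i => measurable_applied_apply k hA (hX i)

/-- Only the perturbations of the other players need be measurable. This is what later makes the
zeroth-order term independent of the own perturbation. -/
theorem measurable_update_applied (k : ℕ) (hA : Measurable A) {i : Fin N}
    (hX : ∀ j ≠ i, Measurable (X j)) (x : EuclideanSpace ℝ (Fin (d i))) :
    Measurable fun ω => Function.update (applied P k (fun j => X j ω) (A ω)) i x := by
  refine measurable_pi_lambda _ fun j => ?_
  by_cases hj : j = i
  · subst hj
    simp
  · simpa [hj] using measurable_applied_apply k hA (hX j hj)

theorem measurable_gradEst (hu : ∀ i, Measurable (G.u i)) (k : ℕ) (hA : Measurable A)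
    (hX : ∀ i, Measurable (X i)) (i : Fin N) :
    Measurable fun ω => gradEst G P k (fun j => X j ω) (A ω) i :=
  (((hu i).comp (measurable_applied k hA hX)).const_mul _).smul
    (measurable_subtype_coe.comp (hX i))

theorem measurable_update (hG : G.IsRegular) (hu : ∀ i, Measurable (G.u i)) (k : ℕ)
    (hA : Measurable A) (hX : ∀ i, Measurable (X i)) (hJ : ∀ i, Measurable (J i)) :
    Measurable fun ω => update G P k (fun j => X j ω) (fun j => J j ω) (A ω) := by
  refine measurable_pi_lambda _ fun i => ?_
  have hAi : Measurable fun ω => A ω i := (measurable_pi_apply i).comp hA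
  have hg := measurable_gradEst (P := P) hu k hA hX i
  refine Measurable.ite (hJ i (measurableSet_singleton true)) ?_ hAi
  exact (continuous_proj (hG.isCompact i) (hG.nonempty i) (hG.convex i)).measurable.comp
    (hAi.add (hg.const_smul (P.step i k)))

end Measurability

section Bias

variable {Ω : Type*} [MeasurableSpace Ω] {μ : Measure Ω} {p : Fin N → ℝ}
  {a₁ : Ω → Profile d} {lam : (i : Fin N) → ℕ → Ω → UnitSphere (d i)}
  {I : Fin N → ℕ → Ω → Bool}

namespace IsSampling

/-- The law of a random variable on a probability space has mass one; this also excludes dimension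
zero. -/
theorem isProbabilityMeasure_uniformSphere [IsProbabilityMeasure μ] (h : IsSampling a₁ lam I μ p) (i : Fin N) :
    IsProbabilityMeasure (uniformSphere (d i)) := by
  rw [← h.law_lam i 0]
  exact Measure.isProbabilityMeasure_map (h.measurable_lam i 0).aemeasurable

theorem measurable_inner_lam (h : IsSampling a₁ lam I μ p) (i : Fin N) (k : ℕ)
    (v : EuclideanSpace ℝ (Fin (d i))) :
    Measurable fun ω => ⟪v, (lam i k ω : EuclideanSpace ℝ (Fin (d i)))⟫ :=
  (measurable_inner_sphere v).comp (h.measurable_lam i k)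

theorem integral_comp_lam (h : IsSampling a₁ lam I μ p) (i : Fin N) (k : ℕ)
    {f : UnitSphere (d i) → ℝ} (hf : Measurable f) :
    ∫ ω, f (lam i k ω) ∂μ = ∫ x, f x ∂uniformSphere (d i) := by
  rw [← h.law_lam i k]
  exact (integral_map (h.measurable_lam i k).aemeasurable hf.aestronglyMeasurable).symm

theorem indepFun_lam (h : IsSampling a₁ lam I μ p) (k : ℕ) (i : Fin N) {f : Ω → ℝ}
    (hf : Measurable[⨆ j, ⨆ _ : j ≠ i, MeasurableSpace.comap (lam j k) inferInstance] f)
    {φ : UnitSphere (d i) → ℝ} (hφ : Measurable φ) :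
    IndepFun f (fun ω => φ (lam i k ω)) μ := by
  have hind := indep_iSup_of_disjoint (S := {s | ∃ j ≠ i, s = Sum.inl j}) (T := {Sum.inl i})
    (by
      rintro (j | j)
      · exact (h.measurable_lam j k).comap_le
      · exact (h.measurable_ind j k).comap_le) (h.indep_stage k)
    (by simp)
  refine indep_of_indep_of_le_left (indep_of_indep_of_le_right hind ?_) ?_
  · refine Measurable.comap_le ?_
    refine Measurable.mono (hφ.comp (comap_measurable (lam i k))) ?_ le_rfl
    exact le_iSup₂_of_le (Sum.inl i) rfl le_rfl
  · refine (Measurable.comap_le hf).trans (iSup₂_le fun j hj => ?_)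
    exact le_iSup₂_of_le (Sum.inl j) ⟨j, hj, rfl⟩ le_rfl

/-- At a given stage the indicator of player `i` is independent of all perturbations jointly, so it
contributes the factor `p i`. -/
theorem integral_ite_ind (h : IsSampling a₁ lam I μ p) (k : ℕ) (i : Fin N) {f : Ω → ℝ}
    (hf : Measurable[⨆ j, MeasurableSpace.comap (lam j k) inferInstance] f) :
    ∫ ω, (if I i k ω = true then f ω else 0) ∂μ = p i * ∫ ω, f ω ∂μ := by
  have hle : (⨆ j, MeasurableSpace.comap (lam j k) inferInstance) ≤ (inferInstance :
      MeasurableSpace Ω) := iSup_le fun j => (h.measurable_lam j k).comap_le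
  have hset : MeasurableSet {ω | I i k ω = true} :=
    h.measurable_ind i k (measurableSet_singleton true)
  have hind := indep_iSup_of_disjoint (S := {Sum.inr i}) (T := Set.range Sum.inl)
    (by
      rintro (j | j)
      · exact (h.measurable_lam j k).comap_le
      · exact (h.measurable_ind j k).comap_le) (h.indep_stage k)
    (by simp)
  have hIF : IndepFun (fun ω => (if I i k ω = true then (1 : ℝ) else 0)) f μ := by
    refine indep_of_indep_of_le_left (indep_of_indep_of_le_right hind ?_) ?_
    · refine (Measurable.comap_le hf).trans (iSup_le fun j => ?_)
      exact le_iSup₂_of_le (Sum.inl j) ⟨j, rfl⟩ le_rfl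
    · refine Measurable.comap_le ?_
      refine Measurable.mono ((measurable_of_finite fun b : Bool =>
        (if b = true then (1 : ℝ) else 0)).comp (comap_measurable (I i k))) ?_ le_rfl
      exact le_iSup₂_of_le (Sum.inr i) rfl le_rfl
  have hone : ∫ ω, (if I i k ω = true then (1 : ℝ) else 0) ∂μ = p i := by
    rw [← h.law_ind i k, ← integral_indicator_one hset]
    refine integral_congr_ae (.of_forall fun ω => ?_)
    simp [Set.indicator_apply]
  rw [← hone, ← hIF.integral_fun_mul_eq_mul_integral
    (Measurable.ite hset measurable_const measurable_const).aestronglyMeasurable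
    (hf.mono hle le_rfl).aestronglyMeasurable]
  refine integral_congr_ae (.of_forall fun ω => ?_)
  simp

/-- The bias of the one-point gradient estimator is of the order of the query radius. -/
theorem exists_bias_bound [IsProbabilityMeasure μ] (h : IsSampling a₁ lam I μ p) (hG : G.IsRegular)
    (hu : ∀ i, Measurable (G.u i)) (P : Params d) : ∃ C : ℝ, 0 ≤ C ∧
    ∀ k, P.IsSafe G k → ∀ a ∈ G.actions, ∀ (i : Fin N) (w : EuclideanSpace ℝ (Fin (d i))),
      |∫ ω, ⟪gradEst G P k (fun j => lam j k ω) a i, w⟫ ∂μ - ⟪G.partialGrad i a, w⟫| ≤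
        C * P.δ k * ‖w‖ := by
  obtain ⟨C, hC0, hC⟩ := exists_expansion_bound hG P
  obtain ⟨B, hB0, hB⟩ := hG.exists_utility_bound
  refine ⟨∑ j, d j * C, Finset.sum_nonneg fun j _ => by positivity, fun k hP a ha i w => ?_⟩
  have := h.isProbabilityMeasure_uniformSphere i
  set g := G.partialGrad i a
  set x := a i + P.δ k • (0 - (P.r i)⁻¹ • (a i - P.c i))
  set l : Ω → EuclideanSpace ℝ (Fin (d i)) := fun ω => lam i k ω
  set U : Ω → Profile d := fun ω => applied P k (fun j => lam j k ω) a
  -- Splitting `u_i(â) = V + δ⟪g, l⟫ + R`: `V` is independent of `l`, and `R` is `O(δ²)`.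
  set V : Ω → ℝ := fun ω => G.u i (Function.update (U ω) i x)
  set R : Ω → ℝ := fun ω => G.u i (U ω) - V ω - P.δ k * ⟪g, l ω⟫
  have hxA : x ∈ G.A i := hP.perturb_mem hG ha i (by simp)
  have hU : Measurable U := measurable_applied k measurable_const fun j => h.measurable_lam j k
  have hV' : Measurable[⨆ j, ⨆ _ : j ≠ i, MeasurableSpace.comap (lam j k) inferInstance] V := by
    refine (hu i).comp ?_
    refine @measurable_update_applied N d P Ω (⨆ j, ⨆ _ : j ≠ i,
      MeasurableSpace.comap (lam j k) inferInstance) (fun j => lam j k) (fun _ => a) k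
      measurable_const i (fun j hj => ?_) x
    exact (comap_measurable (lam j k)).mono (le_iSup₂_of_le j hj le_rfl) le_rfl
  have hV : Measurable V :=
    (hu i).comp (measurable_update_applied k measurable_const (fun j _ => h.measurable_lam j k) x)
  have hgl := h.measurable_inner_lam i k g
  have hwl := h.measurable_inner_lam i k w
  have hR : Measurable R := (((hu i).comp hU).sub hV).sub (hgl.const_mul _)
  have hwb : ∀ ω, |⟪w, l ω⟫| ≤ ‖w‖ := fun ω => abs_inner_sphere_le w (lam i k ω)
  have hI1 : Integrable (fun ω => V ω * ⟪w, l ω⟫) μ := by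
    refine Integrable.of_bound (hV.mul hwl).aestronglyMeasurable (B * ‖w‖)
      (.of_forall fun ω => ?_)
    rw [norm_mul]
    exact mul_le_mul (hB i _ (Game.update_mem_actions (hP.applied_mem hG ha _) hxA)) (hwb ω)
      (norm_nonneg _) hB0
  have hI2 : Integrable (fun ω => ⟪g, l ω⟫ * ⟪w, l ω⟫) μ := by
    refine Integrable.of_bound (hgl.mul hwl).aestronglyMeasurable (‖g‖ * ‖w‖)
      (.of_forall fun ω => ?_)
    rw [norm_mul]
    exact mul_le_mul (abs_inner_sphere_le g (lam i k ω)) (hwb ω) (norm_nonneg _) (norm_nonneg _)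
  have hRb : ∀ ω, ‖R ω * ⟪w, l ω⟫‖ ≤ C * P.δ k ^ 2 * ‖w‖ := fun ω => by
    rw [norm_mul]
    exact mul_le_mul (hC k hP a ha _ i) (hwb ω) (norm_nonneg _) (by positivity)
  have hI3 : Integrable (fun ω => R ω * ⟪w, l ω⟫) μ :=
    Integrable.of_bound (hR.mul hwl).aestronglyMeasurable _ (.of_forall hRb)
  have hz : ∫ ω, V ω * ⟪w, l ω⟫ ∂μ = 0 := by
    rw [(h.indepFun_lam k i hV' (measurable_inner_sphere w)).integral_fun_mul_eq_mul_integral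
      hV.aestronglyMeasurable hwl.aestronglyMeasurable,
      h.integral_comp_lam i k (measurable_inner_sphere w), integral_inner_uniformSphere, mul_zero]
  -- The factor `d i` in the estimator exactly undoes the covariance `1 / d i` of the sphere.
  have hcov : (d i : ℝ) * ∫ ω, ⟪g, l ω⟫ * ⟪w, l ω⟫ ∂μ = ⟪g, w⟫ := by
    have e := h.integral_comp_lam i k
      ((measurable_inner_sphere g).mul (measurable_inner_sphere w))
    simp only [Pi.mul_apply] at e
    rw [e]
    exact integral_inner_mul_inner_uniformSphere g w
  have hdec : ∀ ω, ⟪gradEst G P k (fun j => lam j k ω) a i, w⟫ =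
      d i / P.δ k * (V ω * ⟪w, l ω⟫) + d i * (⟪g, l ω⟫ * ⟪w, l ω⟫) +
        d i / P.δ k * (R ω * ⟪w, l ω⟫) := by
    intro ω
    have hδ := hP.pos.ne'
    rw [gradEst, real_inner_smul_left, real_inner_comm]
    simp only [R, U, l]
    field_simp
    ring
  have hmean : ∫ ω, ⟪gradEst G P k (fun j => lam j k ω) a i, w⟫ ∂μ =
      ⟪g, w⟫ + d i / P.δ k * ∫ ω, R ω * ⟪w, l ω⟫ ∂μ := by
    simp only [hdec]
    have h1 := hI1.const_mul (d i / P.δ k)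
    have h2 := hI2.const_mul (d i : ℝ)
    have h3 := hI3.const_mul (d i / P.δ k)
    have h12 : Integrable (fun ω => d i / P.δ k * (V ω * ⟪w, l ω⟫) +
      d i * (⟪g, l ω⟫ * ⟪w, l ω⟫)) μ := h1.add h2
    rw [integral_add h12 h3, integral_add h1 h2, integral_const_mul, integral_const_mul,
      integral_const_mul, hz, hcov, mul_zero, zero_add]
  rw [hmean, add_sub_cancel_left, abs_mul,
    abs_of_nonneg (div_nonneg (Nat.cast_nonneg _) hP.pos.le)]
  have hn : |∫ ω, R ω * ⟪w, l ω⟫ ∂μ| ≤ C * P.δ k ^ 2 * ‖w‖ := by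
    simpa using norm_integral_le_of_norm_le_const (μ := μ) (.of_forall hRb)
  calc d i / P.δ k * |∫ ω, R ω * ⟪w, l ω⟫ ∂μ| ≤ d i / P.δ k * (C * P.δ k ^ 2 * ‖w‖) :=
        mul_le_mul_of_nonneg_left hn (div_nonneg (Nat.cast_nonneg _) hP.pos.le)
    _ = d i * C * P.δ k * ‖w‖ := by have := hP.pos.ne'; field_simp
    _ ≤ _ := by
        have := hP.pos
        gcongr
        exact Finset.single_le_sum (f := fun j => (d j : ℝ) * C) (fun j _ => by positivity)
          (Finset.mem_univ i)

end IsSampling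

end Bias

end Estimator

/-! ### Almost sure convergence of square-summable martingale sums -/

section Martingale

variable {Ω : Type*} [mΩ : MeasurableSpace Ω] {μ : Measure Ω} [IsProbabilityMeasure μ]

/-- Fubini for the product law: by independence the past `W` may be frozen while the fresh draw `Y`
is averaged. It replaces conditional expectations in the treatment of the noise. -/
theorem integral_eq_zero_of_indepFun {α β : Type*} [MeasurableSpace α] [MeasurableSpace β]
    {W : Ω → α} {Y : Ω → β} (hW : Measurable W) (hY : Measurable Y) (hind : IndepFun W Y μ)
    {f : α × β → ℝ} (hf : Measurable f) (hint : Integrable (fun ω => f (W ω, Y ω)) μ)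
    (h0 : ∀ ω, ∫ ω', f (W ω, Y ω') ∂μ = 0) : ∫ ω, f (W ω, Y ω) ∂μ = 0 := by
  have hWY : AEMeasurable (fun ω => (W ω, Y ω)) μ := (hW.prodMk hY).aemeasurable
  have hlaw := (indepFun_iff_map_prod_eq_prod_map_map hW.aemeasurable hY.aemeasurable).1 hind
  have := Measure.isProbabilityMeasure_map (μ := μ) hW.aemeasurable
  have := Measure.isProbabilityMeasure_map (μ := μ) hY.aemeasurable
  have hint' : Integrable f ((μ.map W).prod (μ.map Y)) := by
    rw [← hlaw]
    exact (integrable_map_measure hf.aestronglyMeasurable hWY).2 hint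
  rw [← integral_map hWY (f := f) hf.aestronglyMeasurable, hlaw, integral_prod _ hint',
    integral_map hW.aemeasurable hint'.integral_prod_left.aestronglyMeasurable]
  refine integral_eq_zero_of_ae (.of_forall fun ω => ?_)
  have hfω : Measurable fun y => f (W ω, y) := hf.comp measurable_prodMk_left
  exact (integral_map hY.aemeasurable hfω.aestronglyMeasurable).trans (h0 ω)

/-- Bounded martingale differences with square-summable bounds have convergent sums. -/
theorem ae_exists_tendsto_sum_of_orthogonal {ℱ : Filtration ℕ mΩ} {ξ : ℕ → Ω → ℝ} {c : ℕ → ℝ}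
    (hmeas : ∀ n, Measurable[ℱ (n + 1)] (ξ n)) (hbdd : ∀ n ω, |ξ n ω| ≤ c n)
    (hc : Summable fun n => c n ^ 2)
    (horth : ∀ n (Z : Ω → ℝ), Measurable[ℱ n] Z → (∃ C, ∀ ω, |Z ω| ≤ C) →
      ∫ ω, Z ω * ξ n ω ∂μ = 0) :
    ∀ᵐ ω ∂μ, ∃ l, Tendsto (fun n => ∑ k ∈ Finset.range n, ξ k ω) atTop (𝓝 l) := by
  set M : ℕ → Ω → ℝ := fun n ω => ∑ k ∈ Finset.range n, ξ k ω with hM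
  have hMadp : ∀ n, Measurable[ℱ n] (M n) := fun n =>
    Finset.measurable_fun_sum _ fun k hk =>
      (hmeas k).mono (ℱ.mono (Finset.mem_range.1 hk)) le_rfl
  have hMmeas : ∀ n, Measurable (M n) := fun n => (hMadp n).mono (ℱ.le n) le_rfl
  have hξmeas : ∀ n, Measurable (ξ n) := fun n => (hmeas n).mono (ℱ.le _) le_rfl
  have hMb : ∀ n ω, |M n ω| ≤ ∑ k ∈ Finset.range n, c k := fun n ω =>
    (Finset.abs_sum_le_sum_abs _ _).trans (Finset.sum_le_sum fun k _ => hbdd k ω)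
  have hMi : ∀ n, Integrable (M n) μ := fun n =>
    Integrable.of_bound (hMmeas n).aestronglyMeasurable _ (.of_forall (hMb n))
  have hξi : ∀ n, Integrable (ξ n) μ := fun n =>
    Integrable.of_bound (hξmeas n).aestronglyMeasurable _ (.of_forall (hbdd n))
  have hMM : ∀ n, Integrable (fun ω => M n ω ^ 2) μ := fun n => by
    simpa only [sq] using (hMi n).bdd_mul (hMmeas n).aestronglyMeasurable (.of_forall (hMb n))
  have hMξ : ∀ n, Integrable (fun ω => M n ω * ξ n ω) μ := fun n =>
    (hξi n).bdd_mul (hMmeas n).aestronglyMeasurable (.of_forall (hMb n))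
  have hξξ : ∀ n, Integrable (fun ω => ξ n ω ^ 2) μ := fun n => by
    simpa only [sq] using (hξi n).bdd_mul (hξmeas n).aestronglyMeasurable (.of_forall (hbdd n))
  have hsucc : ∀ n ω, M (n + 1) ω = M n ω + ξ n ω := fun n ω => Finset.sum_range_succ _ _
  -- Orthogonality to indicators of past events is the martingale property; below, orthogonality to
  -- `M n` itself removes the cross term in the `L²` estimate.
  have hmart : Martingale M ℱ μ := by
    refine martingale_of_setIntegral_eq_succ (fun n => (hMadp n).stronglyMeasurable) hMi
      fun n s hs => ?_
    have hind : Measurable[ℱ n] (s.indicator (1 : Ω → ℝ)) :=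
      Measurable.indicator (m := ℱ n) (@measurable_one _ _ _ (ℱ n) _) hs
    simp only [hsucc]
    rw [integral_add (hMi n).integrableOn (hξi n).integrableOn, left_eq_add,
      ← integral_indicator (ℱ.le n s hs), ← horth n (s.indicator 1) hind ⟨1, fun ω => ?_⟩]
    · refine integral_congr_ae (.of_forall fun ω => ?_)
      by_cases h : ω ∈ s <;> simp [h]
    · by_cases h : ω ∈ s <;> simp [h]
  have hL2 : ∀ n, ∫ ω, M n ω ^ 2 ∂μ ≤ ∑ k ∈ Finset.range n, c k ^ 2 := by
    intro n
    induction n with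
    | zero => simp [hM]
    | succ n ih =>
      have e : ∀ ω, M (n + 1) ω ^ 2 = M n ω ^ 2 + 2 * (M n ω * ξ n ω) + ξ n ω ^ 2 := fun ω => by
        rw [hsucc]; ring
      have hsum : Integrable (fun ω => M n ω ^ 2 + 2 * (M n ω * ξ n ω)) μ :=
        (hMM n).add ((hMξ n).const_mul 2)
      simp only [e]
      rw [integral_add hsum (hξξ n), integral_add (hMM n) ((hMξ n).const_mul 2),
        integral_const_mul, horth n _ (hMadp n) ⟨_, hMb n⟩, mul_zero, add_zero,
        Finset.sum_range_succ]
      refine add_le_add ih ?_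
      calc ∫ ω, ξ n ω ^ 2 ∂μ ≤ ∫ _, c n ^ 2 ∂μ :=
            integral_mono (hξξ n) (integrable_const _) fun ω =>
              sq_le_sq' (abs_le.1 (hbdd n ω)).1 (abs_le.1 (hbdd n ω)).2
        _ = c n ^ 2 := by simp
  have hL1 : ∀ n, eLpNorm (M n) 1 μ ≤ (1 + ∑' k, c k ^ 2).toNNReal := by
    intro n
    rw [eLpNorm_one_eq_lintegral_enorm, ← ofReal_integral_norm_eq_lintegral_enorm (hMi n)]
    refine ENNReal.ofReal_le_ofReal ?_
    calc ∫ ω, ‖M n ω‖ ∂μ ≤ ∫ ω, (1 + M n ω ^ 2) ∂μ :=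
          integral_mono (hMi n).norm ((integrable_const 1).add (hMM n)) fun ω => by
            rw [Real.norm_eq_abs, ← sq_abs (M n ω)]
            -- `|M| ≤ 1 + M²` turns the `L²` bound into the `L¹` bound required for martingale
            -- convergence.
            nlinarith [sq_nonneg (|M n ω| - 1)]
      _ = 1 + ∫ ω, M n ω ^ 2 ∂μ := by rw [integral_add (integrable_const 1) (hMM n)]; simp
      _ ≤ _ := by
          gcongr
          exact (hL2 n).trans (hc.sum_le_tsum _ fun k _ => sq_nonneg _)
  filter_upwards [hmart.submartingale.ae_tendsto_limitProcess hL1] with ω hω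
  exact ⟨_, hω⟩

end Martingale

/-- A deterministic quasi-Fejér argument: a Lyapunov function which decreases up to convergent
perturbations by a non-summable multiple of a dissipation vanishing only at its zeros tends to
zero. -/
theorem tendsto_zero_of_quasi_fejer {E : Type*} [TopologicalSpace E] {K : Set E}
    (hK : IsCompact K) {V φ : E → ℝ} (hV : Continuous V) (hφ : ContinuousOn φ K)
    (hV0 : ∀ x, 0 ≤ V x) (hφ0 : ∀ x ∈ K, 0 ≤ φ x) (hφV : ∀ x ∈ K, φ x = 0 → V x = 0)
    {x : ℕ → E} (hx : ∀ k, x k ∈ K) {γ ξ e : ℕ → ℝ} (hγ : ∀ k, 0 ≤ γ k)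
    (hγ_sum : Tendsto (fun n => ∑ k ∈ Finset.range n, γ k) atTop atTop) (he : Summable e)
    {l : ℝ} (hξ : Tendsto (fun n => ∑ k ∈ Finset.range n, ξ k) atTop (𝓝 l))
    (hstep : ∀ k, V (x (k + 1)) ≤ V (x k) - γ k * φ (x k) + ξ k + e k) :
    Tendsto (fun k => V (x k)) atTop (𝓝 0) := by
  set Q : ℕ → ℝ := fun n => ∑ k ∈ Finset.range n, γ k * φ (x k) with hQ
  set p : ℕ → ℝ := fun n => ∑ k ∈ Finset.range n, ξ k + ∑ k ∈ Finset.range n, e k with hp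
  have hplim : Tendsto p atTop (𝓝 (l + ∑' k, e k)) := hξ.add he.hasSum.tendsto_sum_nat
  have hterm : ∀ k, 0 ≤ γ k * φ (x k) := fun k => mul_nonneg (hγ k) (hφ0 _ (hx k))
  have hQ0 : ∀ n, 0 ≤ Q n := fun n => Finset.sum_nonneg fun k _ => hterm k
  -- Adding the accumulated dissipation and subtracting the accumulated perturbations turns `V` into
  -- a monotone, bounded below quantity. Hence the dissipation is summable and `V` converges.
  have hanti : Antitone fun n => V (x n) + Q n - p n := antitone_nat_of_succ_le fun n => by
    simp only [hQ, hp, Finset.sum_range_succ]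
    linarith [hstep n]
  obtain ⟨B, hB⟩ := hplim.bddAbove_range
  have hS : ∃ s, Tendsto (fun n => V (x n) + Q n - p n) atTop (𝓝 s) :=
    ⟨_, tendsto_atTop_ciInf hanti ⟨-B, by
      rintro _ ⟨n, rfl⟩
      have := hB ⟨n, rfl⟩
      have := hV0 (x n)
      have := hQ0 n
      simp only
      linarith⟩⟩
  obtain ⟨s, hs⟩ := hS
  have hVQ : Tendsto (fun n => V (x n) + Q n) atTop (𝓝 (s + (l + ∑' k, e k))) := by
    simpa using hs.add hplim
  obtain ⟨B', hB'⟩ := hVQ.bddAbove_range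
  have hsummable : Summable fun k => γ k * φ (x k) :=
    summable_of_sum_range_le hterm fun n => by
      have := hB' ⟨n, rfl⟩
      have := hV0 (x n)
      simp only at *
      linarith
  have hVlim : Tendsto (fun n => V (x n)) atTop
      (𝓝 (s + (l + ∑' k, e k) - ∑' k, γ k * φ (x k))) := by
    refine (hVQ.sub hsummable.hasSum.tendsto_sum_nat).congr fun n => ?_
    simp only [hQ, add_sub_cancel_right]
  set v := s + (l + ∑' k, e k) - ∑' k, γ k * φ (x k)
  have hv0 : 0 ≤ v := ge_of_tendsto' hVlim fun n => hV0 _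
  rcases hv0.eq_or_lt with hv | hv
  · rwa [← hv] at hVlim
  exfalso
  -- If the limit `v` were positive, the sequence would stay eventually in this compact set, where
  -- the dissipation has a positive minimum; then `γ` would be summable.
  have hK' : IsCompact (K ∩ {y | v / 2 ≤ V y}) :=
    hK.inter_right (isClosed_le continuous_const hV)
  have hev : ∀ᶠ n in atTop, x n ∈ K ∩ {y | v / 2 ≤ V y} := by
    filter_upwards [hVlim.eventually (lt_mem_nhds (half_lt_self hv))] with n hn
    exact ⟨hx n, hn.le⟩
  obtain ⟨n₀, hn₀⟩ := hev.exists
  obtain ⟨y, hy, hmin⟩ := hK'.exists_isMinOn ⟨_, hn₀⟩ (hφ.mono Set.inter_subset_left)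
  have hm : 0 < φ y := lt_of_le_of_ne (hφ0 y hy.1) fun h => by
    have h1 := hφV y hy.1 h.symm
    have h2 : v / 2 ≤ V y := hy.2
    linarith
  have hγs : Summable γ := by
    refine Summable.of_norm_bounded_eventually_nat (hsummable.mul_left (φ y)⁻¹) ?_
    filter_upwards [hev] with n hn
    rw [Real.norm_of_nonneg (hγ n), ← div_eq_inv_mul, le_div_iff₀ hm]
    exact mul_le_mul_of_nonneg_left (hmin hn) (hγ n)
  exact not_tendsto_atTop_of_tendsto_nhds hγs.hasSum.tendsto_sum_nat hγ_sum

/-! ### The Lyapunov recursion and almost sure convergence -/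

section Convergence

variable {N : ℕ} {d : Fin N → ℕ} {G : Game d} {P : Params d}

/-- The first-order change of the squared distance to `b` in one round. -/
def increment (G : Game d) (P : Params d) (b : Profile d) (k : ℕ)
    (lam : (i : Fin N) → UnitSphere (d i)) (I : Fin N → Bool) (a : Profile d) : ℝ :=
  ∑ i, if I i = true then 2 * P.step i k * ⟪gradEst G P k lam a i, a i - b i⟫ else 0

theorem measurable_increment {Ω : Type*} [MeasurableSpace Ω] {X : (i : Fin N) → Ω → UnitSphere (d i)}
    {J : Fin N → Ω → Bool} {A : Ω → Profile d} (hu : ∀ i, Measurable (G.u i)) (b : Profile d)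
    (k : ℕ) (hX : ∀ i, Measurable (X i)) (hJ : ∀ i, Measurable (J i)) (hA : Measurable A) :
    Measurable fun ω => increment G P b k (fun i => X i ω) (fun i => J i ω) (A ω) := by
  refine Finset.measurable_fun_sum _ fun i _ => ?_
  have hAi : Measurable fun ω => A ω i := (measurable_pi_apply i).comp hA
  refine Measurable.ite (hJ i (measurableSet_singleton true)) ?_ measurable_const
  exact ((measurable_gradEst hu k hA hX i).inner (hAi.sub measurable_const)).const_mul _

theorem measurable_increment_uncurry (hu : ∀ i, Measurable (G.u i)) (P : Params d) (b : Profile d)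
    (k : ℕ) : Measurable fun x : Profile d × (((i : Fin N) → UnitSphere (d i)) × (Fin N → Bool)) =>
      increment G P b k x.2.1 x.2.2 x.1 := by
  have hX : ∀ i, Measurable fun x : Profile d × (((i : Fin N) → UnitSphere (d i)) ×
      (Fin N → Bool)) => x.2.1 i := fun i =>
    (measurable_pi_apply i).comp (measurable_fst.comp measurable_snd)
  have hJ : ∀ i, Measurable fun x : Profile d × (((i : Fin N) → UnitSphere (d i)) ×
      (Fin N → Bool)) => x.2.2 i := fun i =>
    (measurable_pi_apply i).comp (measurable_snd.comp measurable_snd)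
  exact measurable_increment hu b k hX hJ measurable_fst

/-- Utilities are bounded on the action space, so only the factor `1 / δ` blows up. This is the
origin of the condition on `γ² / δ²`. -/
theorem exists_gradEst_bound (hG : G.IsRegular) (P : Params d) : ∃ B : ℝ, 0 ≤ B ∧
    ∀ k, P.IsSafe G k → ∀ a ∈ G.actions, ∀ (lam : (i : Fin N) → UnitSphere (d i)) (i : Fin N),
      ‖gradEst G P k lam a i‖ ≤ B / P.δ k := by
  obtain ⟨B, hB0, hB⟩ := hG.exists_utility_bound
  refine ⟨∑ j, d j * B, Finset.sum_nonneg fun j _ => by positivity, fun k hP a ha lam i => ?_⟩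
  have h1 : ‖gradEst G P k lam a i‖ = d i / P.δ k * |G.u i (applied P k lam a)| := by
    rw [gradEst, norm_smul, norm_mul, Real.norm_of_nonneg (div_nonneg (Nat.cast_nonneg _) hP.pos.le)]
    simp
  rw [h1]
  calc d i / P.δ k * |G.u i (applied P k lam a)| ≤ d i / P.δ k * B :=
        mul_le_mul_of_nonneg_left (hB i _ (hP.applied_mem hG ha lam))
          (div_nonneg (Nat.cast_nonneg _) hP.pos.le)
    _ = d i * B / P.δ k := by ring
    _ ≤ _ := by
        have := hP.pos
        gcongr
        exact Finset.single_le_sum (f := fun j => (d j : ℝ) * B) (fun j _ => by positivity)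
          (Finset.mem_univ i)

section Steps

variable {γ : ℕ → ℝ} {p : Fin N → ℝ}

theorem exists_increment_bound (hG : G.IsRegular) (P : Params d) (hp : ∀ i, 0 < p i)
    (hγ : ∀ k, 0 < γ k) (hstep : ∀ i k, P.step i k = γ k / p i) : ∃ C : ℝ, 0 ≤ C ∧
    ∀ k, P.IsSafe G k → ∀ a ∈ G.actions, ∀ b ∈ G.actions,
      ∀ (lam : (i : Fin N) → UnitSphere (d i)) (I : Fin N → Bool),
      |increment G P b k lam I a| ≤ C * (γ k / P.δ k) := by
  obtain ⟨B, hB0, hB⟩ := exists_gradEst_bound hG P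
  obtain ⟨R, hR0, hR⟩ := hG.exists_diameter_bound
  refine ⟨∑ i, 2 * (p i)⁻¹ * B * R, Finset.sum_nonneg fun i _ => by have := hp i; positivity,
    fun k hP a ha b hb lam I => ?_⟩
  rw [Finset.sum_mul]
  refine (Finset.abs_sum_le_sum_abs _ _).trans (Finset.sum_le_sum fun i _ => ?_)
  have hpi := hp i
  have hγk := hγ k
  have hδ := hP.pos
  split_ifs
  · rw [hstep, abs_mul, abs_of_nonneg (by positivity)]
    calc 2 * (γ k / p i) * |⟪gradEst G P k lam a i, a i - b i⟫| ≤
          2 * (γ k / p i) * (B / P.δ k * R) := by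
          gcongr
          exact (abs_real_inner_le_norm _ _).trans
            (mul_le_mul (hB k hP a ha lam i) (hR a ha b hb i) (norm_nonneg _) (by positivity))
      _ = _ := by ring
  · rw [abs_zero]
    positivity

/-- One round of the algorithm changes the squared distance by the increment, up to a second-order
term. -/
theorem exists_descent_bound (hG : G.IsRegular) (P : Params d)
    (hstep : ∀ i k, P.step i k = γ k / p i) : ∃ C : ℝ, 0 ≤ C ∧
    ∀ k, P.IsSafe G k → ∀ a ∈ G.actions, ∀ b ∈ G.actions,
      ∀ (lam : (i : Fin N) → UnitSphere (d i)) (I : Fin N → Bool),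
      ∑ i, ‖update G P k lam I a i - b i‖ ^ 2 ≤
        ∑ i, ‖a i - b i‖ ^ 2 + increment G P b k lam I a + C * (γ k ^ 2 / P.δ k ^ 2) := by
  obtain ⟨B, hB0, hB⟩ := exists_gradEst_bound hG P
  refine ⟨∑ i, ((p i)⁻¹ * B) ^ 2, by positivity, fun k hP a ha b hb lam I => ?_⟩
  rw [increment, Finset.sum_mul, ← Finset.sum_add_distrib, ← Finset.sum_add_distrib]
  refine Finset.sum_le_sum fun i _ => ?_
  have hδ := hP.pos
  simp only [update]
  split_ifs
  · set g := gradEst G P k lam a i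
    have h1 := norm_proj_sub_le (hG.isCompact i) (hG.convex i) (a i + P.step i k • g)
      (hb i trivial)
    refine (pow_le_pow_left₀ (norm_nonneg _) h1 2).trans ?_
    have e : a i + P.step i k • g - b i = (a i - b i) + P.step i k • g := by abel
    rw [e, norm_add_sq_real, inner_smul_right, real_inner_comm, norm_smul, mul_pow,
      Real.norm_eq_abs, sq_abs]
    have h2 : P.step i k ^ 2 * ‖g‖ ^ 2 ≤ ((p i)⁻¹ * B) ^ 2 * (γ k ^ 2 / P.δ k ^ 2) := by
      calc P.step i k ^ 2 * ‖g‖ ^ 2 ≤ P.step i k ^ 2 * (B / P.δ k) ^ 2 := by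
            gcongr
            exact hB k hP a ha lam i
        _ = _ := by rw [hstep]; ring
    linarith
  · have : 0 ≤ ((p i)⁻¹ * B) ^ 2 * (γ k ^ 2 / P.δ k ^ 2) := by positivity
    linarith

variable {Ω : Type*} [mΩ : MeasurableSpace Ω] {μ : Measure Ω} [IsProbabilityMeasure μ]
  {a₁ : Ω → Profile d} {lam : (i : Fin N) → ℕ → Ω → UnitSphere (d i)}
  {I : Fin N → ℕ → Ω → Bool}

omit mΩ in
theorem intended_mem (hG : G.IsRegular) (ha₁ : ∀ ω, a₁ ω ∈ G.actions) (k : ℕ) (ω : Ω) :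
    intended G P a₁ lam I k ω ∈ G.actions := by
  induction k with
  | zero => exact ha₁ ω
  | succ k ih => exact update_mem_actions hG _ _ ih

namespace IsSampling

/-- The action `a` is frozen here, so the integral is the conditional mean of the increment given
the history; the error is the estimator bias, paired with a vector bounded by the diameter. -/
theorem exists_drift_bound (h : IsSampling a₁ lam I μ p) (hG : G.IsRegular)
    (hu : ∀ i, Measurable (G.u i)) (P : Params d) (hp : ∀ i, 0 < p i)
    (hγ : ∀ k, 0 < γ k) (hstep : ∀ i k, P.step i k = γ k / p i) : ∃ C : ℝ, 0 ≤ C ∧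
    ∀ k, P.IsSafe G k → ∀ a ∈ G.actions, ∀ b ∈ G.actions,
      ∫ ω, increment G P b k (fun i => lam i k ω) (fun i => I i k ω) a ∂μ ≤
        2 * γ k * ∑ i, ⟪G.partialGrad i a, a i - b i⟫ + C * (γ k * P.δ k) := by
  obtain ⟨C, hC0, hC⟩ := h.exists_bias_bound hG hu P
  obtain ⟨B, hB0, hB⟩ := exists_gradEst_bound hG P
  obtain ⟨R, hR0, hR⟩ := hG.exists_diameter_bound
  refine ⟨∑ _i : Fin N, 2 * (C * R), by positivity, fun k hP a ha b hb => ?_⟩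
  have hmeas : ∀ i, Measurable[⨆ j, MeasurableSpace.comap (lam j k) inferInstance]
      fun ω => 2 * P.step i k * ⟪gradEst G P k (fun j => lam j k ω) a i, a i - b i⟫ := by
    intro i
    have h1 := @measurable_gradEst N d G P Ω (⨆ j, MeasurableSpace.comap (lam j k) inferInstance)
      (fun j => lam j k) (fun _ => a) hu k measurable_const
      (fun j => (comap_measurable (lam j k)).mono (le_iSup_of_le j le_rfl) le_rfl) i
    exact (h1.inner measurable_const).const_mul _
  have hle : (⨆ j, MeasurableSpace.comap (lam j k) inferInstance) ≤ mΩ :=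
    iSup_le fun j => (h.measurable_lam j k).comap_le
  have hint : ∀ i ∈ Finset.univ, Integrable (fun ω => if I i k ω = true then
      2 * P.step i k * ⟪gradEst G P k (fun j => lam j k ω) a i, a i - b i⟫ else 0) μ := by
    intro i _
    refine Integrable.of_bound (Measurable.ite (h.measurable_ind i k (measurableSet_singleton true))
      ((hmeas i).mono hle le_rfl) measurable_const).aestronglyMeasurable
      (|2 * P.step i k| * (B / P.δ k * R)) (.of_forall fun ω => ?_)
    have hδ := hP.pos
    split_ifs
    · rw [norm_mul, Real.norm_eq_abs]
      gcongr
      exact (norm_inner_le_norm _ _).trans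
        (mul_le_mul (hB k hP a ha _ i) (hR a ha b hb i) (norm_nonneg _) (by positivity))
    · rw [norm_zero]
      positivity
  simp only [increment]
  rw [integral_finsetSum _ hint, Finset.mul_sum, Finset.sum_mul, ← Finset.sum_add_distrib]
  refine Finset.sum_le_sum fun i _ => ?_
  rw [h.integral_ite_ind k i (hmeas i), integral_const_mul, hstep]
  have hb' := (abs_le.1 (hC k hP a ha i (a i - b i))).2
  have hR' := hR a ha b hb i
  have hpi := hp i
  have hγk := hγ k
  have hδ := hP.pos
  -- The probability of receiving feedback cancels against the step size `γ / p i`, so all players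
  -- drift at the common rate `γ`.
  have e : p i * (2 * (γ k / p i) * ∫ ω, ⟪gradEst G P k (fun j => lam j k ω) a i, a i - b i⟫ ∂μ) =
      2 * γ k * ∫ ω, ⟪gradEst G P k (fun j => lam j k ω) a i, a i - b i⟫ ∂μ := by
    field_simp
  rw [e]
  have h2 : C * P.δ k * ‖a i - b i‖ ≤ C * P.δ k * R := by gcongr
  have h3 : ∫ ω, ⟪gradEst G P k (fun j => lam j k ω) a i, a i - b i⟫ ∂μ ≤
      ⟪G.partialGrad i a, a i - b i⟫ + C * P.δ k * R := by linarith
  calc _ ≤ 2 * γ k * (⟪G.partialGrad i a, a i - b i⟫ + C * P.δ k * R) :=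
        mul_le_mul_of_nonneg_left h3 (by positivity)
    _ = _ := by ring

/-- The filtration of the histories. -/
def filtration (h : IsSampling a₁ lam I μ p) : Filtration ℕ mΩ where
  seq := history a₁ lam I
  mono' s t hst := by
    refine sup_le le_sup_left (le_sup_of_le_right (iSup₂_le fun r hr => ?_))
    exact le_iSup₂_of_le (f := fun r (_ : r < t) => stageSigma lam I r) r (hr.trans_le hst) le_rfl
  le' t := by
    refine sup_le h.measurable_init.comap_le (iSup₂_le fun s _ => iSup_le fun i => ?_)
    exact sup_le (h.measurable_lam i s).comap_le (h.measurable_ind i s).comap_le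

omit [IsProbabilityMeasure μ] in
theorem stageSigma_le_filtration (h : IsSampling a₁ lam I μ p) (k : ℕ) :
    stageSigma lam I k ≤ h.filtration (k + 1) :=
  le_sup_of_le_right (le_iSup₂_of_le k (Nat.lt_succ_self k) le_rfl)

omit mΩ in
theorem measurable_lam_stageSigma (i : Fin N) (k : ℕ) : Measurable[stageSigma lam I k] (lam i k) :=
  (comap_measurable (lam i k)).mono (le_iSup_of_le i le_sup_left) le_rfl

omit mΩ in
theorem measurable_ind_stageSigma (i : Fin N) (k : ℕ) : Measurable[stageSigma lam I k] (I i k) :=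
  (comap_measurable (I i k)).mono (le_iSup_of_le i le_sup_right) le_rfl

omit [IsProbabilityMeasure μ] in
theorem measurable_intended (h : IsSampling a₁ lam I μ p) (hG : G.IsRegular)
    (hu : ∀ i, Measurable (G.u i)) (P : Params d) (k : ℕ) :
    Measurable[h.filtration k] (intended G P a₁ lam I k) := by
  induction k with
  | zero => exact (comap_measurable a₁).mono le_sup_left le_rfl
  | succ k ih =>
    exact @measurable_update N d G P Ω (h.filtration (k + 1)) (fun i => lam i k)
      (fun i => I i k) (intended G P a₁ lam I k) hG hu k
      (ih.mono (h.filtration.mono k.le_succ) le_rfl)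
      (fun i => (measurable_lam_stageSigma i k).mono (h.stageSigma_le_filtration k) le_rfl)
      (fun i => (measurable_ind_stageSigma i k).mono (h.stageSigma_le_filtration k) le_rfl)

omit mΩ in
theorem measurable_draws (k : ℕ) : Measurable[stageSigma lam I k]
    fun ω => ((fun i => lam i k ω, fun i => I i k ω) :
      ((i : Fin N) → UnitSphere (d i)) × (Fin N → Bool)) := by
  let _ : MeasurableSpace Ω := stageSigma lam I k
  have h1 : ∀ i, Measurable (lam i k) := fun i => measurable_lam_stageSigma i k
  have h2 : ∀ i, Measurable (I i k) := fun i => measurable_ind_stageSigma i k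
  exact (measurable_pi_lambda _ h1).prodMk (measurable_pi_lambda _ h2)

/-- Makes the compensator, evaluated at the intended action, measurable with respect to the history.
-/
theorem measurable_integral_increment (h : IsSampling a₁ lam I μ p)
    (hu : ∀ i, Measurable (G.u i)) (P : Params d) (b : Profile d) (k : ℕ) :
    Measurable fun a => ∫ ω, increment G P b k (fun i => lam i k ω) (fun i => I i k ω) a ∂μ := by
  have hY : Measurable fun ω => ((fun i => lam i k ω, fun i => I i k ω) :
      ((i : Fin N) → UnitSphere (d i)) × (Fin N → Bool)) :=
    (measurable_draws k).mono ((h.stageSigma_le_filtration k).trans (h.filtration.le _)) le_rfl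
  have hm : Measurable fun x : Profile d × Ω =>
      increment G P b k (fun i => lam i k x.2) (fun i => I i k x.2) x.1 :=
    (measurable_increment_uncurry hu P b k).comp
      (measurable_fst.prodMk (hY.comp measurable_snd))
  exact (hm.stronglyMeasurable.integral_prod_right' (ν := μ)).measurable

/-- The compensated increments have almost surely convergent sums. -/
theorem ae_exists_tendsto_sum_noise (h : IsSampling a₁ lam I μ p) (hG : G.IsRegular)
    (hu : ∀ i, Measurable (G.u i)) (P : Params d) (hP : ∀ k, P.IsSafe G k) (hp : ∀ i, 0 < p i)
    (hγ : ∀ k, 0 < γ k) (hstep : ∀ i k, P.step i k = γ k / p i)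
    (hsum : Summable fun k => γ k ^ 2 / P.δ k ^ 2) (ha₁ : ∀ ω, a₁ ω ∈ G.actions)
    {b : Profile d} (hb : b ∈ G.actions) :
    ∀ᵐ ω ∂μ, ∃ l, Tendsto (fun n => ∑ k ∈ Finset.range n,
      (increment G P b k (fun i => lam i k ω) (fun i => I i k ω) (intended G P a₁ lam I k ω) -
        ∫ ω', increment G P b k (fun i => lam i k ω') (fun i => I i k ω')
          (intended G P a₁ lam I k ω) ∂μ)) atTop (𝓝 l) := by
  obtain ⟨C, hC0, hC⟩ := exists_increment_bound hG P hp hγ hstep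
  set A := intended G P a₁ lam I
  have hA : ∀ k ω, A k ω ∈ G.actions := intended_mem hG ha₁
  have hAm : ∀ k, Measurable[h.filtration k] (A k) := h.measurable_intended hG hu P
  have hH : ∀ k, ∀ a ∈ G.actions,
      |∫ ω', increment G P b k (fun i => lam i k ω') (fun i => I i k ω') a ∂μ| ≤
        C * (γ k / P.δ k) := fun k a ha => by
    simpa using norm_integral_le_of_norm_le_const (μ := μ)
      (f := fun ω' => increment G P b k (fun i => lam i k ω') (fun i => I i k ω') a)
      (.of_forall fun ω' => hC k (hP k) a ha b hb (fun i => lam i k ω') (fun i => I i k ω'))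
  have hbdd : ∀ k ω, |increment G P b k (fun i => lam i k ω) (fun i => I i k ω) (A k ω) -
        ∫ ω', increment G P b k (fun i => lam i k ω') (fun i => I i k ω') (A k ω) ∂μ| ≤
          2 * C * (γ k / P.δ k) := fun k ω => by
    have h1 := hC k (hP k) _ (hA k ω) b hb (fun i => lam i k ω) (fun i => I i k ω)
    have h2 := hH k _ (hA k ω)
    refine (abs_sub _ _).trans ?_
    linarith
  have hinc : ∀ k a, Measurable fun ω =>
      increment G P b k (fun i => lam i k ω) (fun i => I i k ω) a := fun k a =>
    measurable_increment hu b k (fun i => h.measurable_lam i k) (fun i => h.measurable_ind i k)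
      measurable_const
  have hξm : ∀ k, Measurable[h.filtration (k + 1)] fun ω =>
      increment G P b k (fun i => lam i k ω) (fun i => I i k ω) (A k ω) -
        ∫ ω', increment G P b k (fun i => lam i k ω') (fun i => I i k ω') (A k ω) ∂μ := by
    intro k
    have hA' : Measurable[h.filtration (k + 1)] (A k) :=
      (hAm k).mono (h.filtration.mono k.le_succ) le_rfl
    refine Measurable.sub ?_ ((h.measurable_integral_increment hu P b k).comp hA')
    exact @measurable_increment N d G P Ω (h.filtration (k + 1)) (fun i => lam i k)
      (fun i => I i k) (A k) hu b k
      (fun i => (measurable_lam_stageSigma i k).mono (h.stageSigma_le_filtration k) le_rfl)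
      (fun i => (measurable_ind_stageSigma i k).mono (h.stageSigma_le_filtration k) le_rfl) hA'
  refine ae_exists_tendsto_sum_of_orthogonal (ℱ := h.filtration) hξm hbdd ?_ ?_
  · refine (hsum.mul_left ((2 * C) ^ 2)).congr fun k => ?_
    rw [← div_pow, ← mul_pow]
  · rintro k Z hZ ⟨D, hD⟩
    -- The test variable and the intended action together form the past; the draws of stage `k` are
    -- independent of the pair.
    have hZA : Measurable[h.filtration k] fun ω => (Z ω, A k ω) := hZ.prodMk (hAm k)
    set Y : Ω → ((i : Fin N) → UnitSphere (d i)) × (Fin N → Bool) :=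
      fun ω => (fun i => lam i k ω, fun i => I i k ω)
    have hYs : Measurable[stageSigma lam I k] Y := measurable_draws k
    have hind : IndepFun (fun ω => (Z ω, A k ω)) Y μ :=
      indep_of_indep_of_le_left (indep_of_indep_of_le_right (h.indep_history k).symm
        hYs.comap_le) hZA.comap_le
    have hY : Measurable Y := hYs.mono
      ((h.stageSigma_le_filtration k).trans (h.filtration.le _)) le_rfl
    have hD0 : ∀ ω, 0 ≤ D := fun ω => (abs_nonneg _).trans (hD ω)
    refine integral_eq_zero_of_indepFun (hZA.mono (h.filtration.le k) le_rfl) hY hind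
      (f := fun x => x.1.1 * (increment G P b k x.2.1 x.2.2 x.1.2 -
        ∫ ω', increment G P b k (fun i => lam i k ω') (fun i => I i k ω') x.1.2 ∂μ)) ?_ ?_ ?_
    · refine (measurable_fst.comp measurable_fst).mul (Measurable.sub ?_
        ((h.measurable_integral_increment hu P b k).comp (measurable_snd.comp measurable_fst)))
      exact (measurable_increment_uncurry hu P b k).comp
        ((measurable_snd.comp measurable_fst).prodMk measurable_snd)
    · refine Integrable.of_bound ((hZ.mono (h.filtration.le _) le_rfl).mul
        ((hξm k).mono (h.filtration.le _) le_rfl)).aestronglyMeasurable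
        (D * (2 * C * (γ k / P.δ k))) (.of_forall fun ω => ?_)
      simp only [Y]
      rw [norm_mul]
      exact mul_le_mul (hD ω) (hbdd k ω) (norm_nonneg _) (hD0 ω)
    · intro ω
      have hi : Integrable (fun ω' => increment G P b k (fun i => lam i k ω')
          (fun i => I i k ω') (A k ω)) μ :=
        Integrable.of_bound (hinc k _).aestronglyMeasurable _
          (.of_forall fun ω' => hC k (hP k) _ (hA k ω) b hb _ _)
      simp only [Y]
      rw [integral_const_mul, integral_sub hi (integrable_const _)]
      simp

/-- Almost sure convergence of the applied actions for globally measurable utilities. -/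
theorem ae_tendsto_realized (h : IsSampling a₁ lam I μ p) (hG : G.IsRegular)
    (hmono : G.IsStrictlyMonotone) (hu : ∀ i, Measurable (G.u i)) (P : Params d)
    (hP : ∀ k, P.IsSafe G k) (hp : ∀ i, 0 < p i)
    (hγ : ∀ k, 0 < γ k) (hstep : ∀ i k, P.step i k = γ k / p i)
    (hδ_lim : Tendsto P.δ atTop (𝓝 0))
    (hγ_sum : Tendsto (fun n => ∑ k ∈ Finset.range n, γ k) atTop atTop)
    (hγδ_sum : Summable fun k => γ k * P.δ k) (hsum : Summable fun k => γ k ^ 2 / P.δ k ^ 2)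
    (ha₁ : ∀ ω, a₁ ω ∈ G.actions) {b : Profile d} (hb : G.IsNash b) :
    ∀ᵐ ω ∂μ, Tendsto (fun k => realized G P a₁ lam I k ω) atTop (𝓝 b) := by
  obtain ⟨C, hC0, hC⟩ := h.exists_drift_bound hG hu P hp hγ hstep
  obtain ⟨D, hD0, hD⟩ := exists_descent_bound (γ := γ) (p := p) hG P hstep
  obtain ⟨K, hK0, hK⟩ := exists_displacement_bound hG P
  filter_upwards [h.ae_exists_tendsto_sum_noise hG hu P hP hp hγ hstep hsum ha₁ hb.1]
    with ω ⟨l, hl⟩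
  set A := fun k => intended G P a₁ lam I k ω
  have hA : ∀ k, A k ∈ G.actions := fun k => intended_mem hG ha₁ k ω
  -- Strict monotonicity between `a` and `b`, combined with the variational inequality at `b`, makes
  -- the drift toward `b` strict.
  have hstrict : ∀ a ∈ G.actions, a ≠ b → ∑ i, ⟪G.partialGrad i a, a i - b i⟫ < 0 := by
    intro a ha hab
    have h1 := hmono a ha b hb.1 hab
    have h2 := hG.sum_inner_nonpos hb ha
    simp only [inner_sub_left (G.partialGrad _ _), Finset.sum_sub_distrib] at h1
    linarith
  have hV : Tendsto (fun k => ∑ i, ‖A k i - b i‖ ^ 2) atTop (𝓝 0) := by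
    refine tendsto_zero_of_quasi_fejer hG.isCompact_actions
      (V := fun a => ∑ i, ‖a i - b i‖ ^ 2)
      (φ := fun a => -(2 * ∑ i, ⟪G.partialGrad i a, a i - b i⟫))
      (by fun_prop) ?_ (fun a => by positivity) ?_ ?_ hA (fun k => (hγ k).le) hγ_sum
      (e := fun k => C * (γ k * P.δ k) + D * (γ k ^ 2 / P.δ k ^ 2))
      ((hγδ_sum.mul_left C).add (hsum.mul_left D)) hl ?_
    · refine (continuousOn_const.mul (continuousOn_finsetSum _ fun i _ => ?_)).neg
      exact (hG.continuousOn_partialGrad i).inner (by fun_prop)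
    · intro a ha
      by_cases hab : a = b
      · simp [hab]
      · linarith [hstrict a ha hab]
    · intro a ha h0
      by_cases hab : a = b
      · simp [hab]
      · linarith [hstrict a ha hab]
    · intro k
      -- Increment = noise + compensator: the noise is `ξ`, the drift bound on the compensator
      -- yields `-γ φ`, and both remainders go into `e`.
      have h1 := hD k (hP k) (A k) (hA k) b hb.1 (fun i => lam i k ω) (fun i => I i k ω)
      have h2 := hC k (hP k) (A k) (hA k) b hb.1
      have e : A (k + 1) = update G P k (fun i => lam i k ω) (fun i => I i k ω) (A k) := rfl
      simp only [e]
      simp only [A] at h1 h2 ⊢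
      linarith
  rw [tendsto_pi_nhds]
  intro i
  have hAi : Tendsto (fun k => A k i) atTop (𝓝 (b i)) := by
    rw [tendsto_iff_norm_sub_tendsto_zero]
    have hsq : Tendsto (fun k => ‖A k i - b i‖ ^ 2) atTop (𝓝 0) :=
      squeeze_zero (fun _ => by positivity) (fun k => Finset.single_le_sum
        (f := fun i => ‖A k i - b i‖ ^ 2) (fun j _ => by positivity) (Finset.mem_univ i)) hV
    simpa [Real.sqrt_sq] using hsq.sqrt
  have hdisp : Tendsto (fun k => realized G P a₁ lam I k ω i - A k i) atTop (𝓝 0) := by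
    refine squeeze_zero_norm (a := fun k => P.δ k * K) (fun k => ?_) (by simpa using hδ_lim.mul_const K)
    simpa [realized, applied, A] using hK k (hP k) (A k) (hA k) i (lam i k ω) (by simp)
  simpa using hdisp.add hAi

end IsSampling

end Steps

/-! ### Truncation to globally measurable utilities -/

namespace Game

/-- The game with utilities set to zero outside of the joint action space. -/
def truncate (G : Game d) : Game d where
  A := G.A
  u i := G.actions.indicator (G.u i)

theorem ownUtility_truncate {a : Profile d} (ha : a ∈ G.actions) {i : Fin N}
    {x : EuclideanSpace ℝ (Fin (d i))} (hx : x ∈ G.A i) :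
    G.truncate.ownUtility i a x = G.ownUtility i a x :=
  Set.indicator_of_mem (update_mem_actions ha hx) _

/-- Gradients are taken within `A i`, where the two utilities agree, so the jump at the boundary is
invisible. -/
theorem partialGrad_truncate {a : Profile d} (ha : a ∈ G.actions) (i : Fin N) :
    G.truncate.partialGrad i a = G.partialGrad i a := by
  unfold partialGrad gradientWithin
  exact congrArg _ (fderivWithin_congr (fun x hx => ownUtility_truncate ha hx)
    (ownUtility_truncate ha (ha i trivial)))

theorem IsRegular.truncate (hG : G.IsRegular) : G.truncate.IsRegular where
  isClosed := hG.isClosed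
  isCompact := hG.isCompact
  convex := hG.convex
  interior_nonempty := hG.interior_nonempty
  continuousOn i := (hG.continuousOn i).congr fun _ ha => Set.indicator_of_mem ha _
  concave i _ ha := (hG.concave i _ ha).congr fun _ hx => (ownUtility_truncate (G := G) ha hx).symm
  contDiff i _ ha := (hG.contDiff i _ ha).congr fun _ hx => ownUtility_truncate (G := G) ha hx
  lipschitz i := by
    obtain ⟨L, hL⟩ := hG.lipschitz i
    refine ⟨L, fun a ha a' ha' => ?_⟩
    rw [partialGrad_truncate (G := G) ha, partialGrad_truncate (G := G) ha']
    exact hL a ha a' ha'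

theorem IsStrictlyMonotone.truncate (hG : G.IsStrictlyMonotone) :
    G.truncate.IsStrictlyMonotone := by
  intro a ha a' ha' hne
  simp only [partialGrad_truncate (G := G) ha, partialGrad_truncate (G := G) ha']
  exact hG a ha a' ha' hne

theorem IsNash.truncate {a : Profile d} (ha : G.IsNash a) : G.truncate.IsNash a := by
  refine ⟨ha.1, fun i x hx => ?_⟩
  have h1 : G.truncate.u i (Function.update a i x) = G.u i (Function.update a i x) :=
    Set.indicator_of_mem (update_mem_actions ha.1 hx) _
  have h2 : G.truncate.u i a = G.u i a := Set.indicator_of_mem ha.1 _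
  rw [h1, h2]
  exact ha.2 i x hx

theorem IsRegular.measurable_truncate (hG : G.IsRegular) (i : Fin N) :
    Measurable (G.truncate.u i) := by
  classical
  have h := (hG.continuousOn i).measurable_piecewise (g := fun _ => (0 : ℝ)) continuousOn_const
    hG.isClosed_actions.measurableSet
  rwa [show G.actions.piecewise (G.u i) (fun _ => (0 : ℝ)) = G.truncate.u i from
    Set.piecewise_eq_indicator] at h

end Game

theorem update_truncate (hG : G.IsRegular) {k : ℕ} (hP : P.IsSafe G k)
    (lam : (i : Fin N) → UnitSphere (d i)) (I : Fin N → Bool) {a : Profile d}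
    (ha : a ∈ G.actions) : update G.truncate P k lam I a = update G P k lam I a := by
  funext i
  have h : G.truncate.u i (applied P k lam a) = G.u i (applied P k lam a) :=
    Set.indicator_of_mem (hP.applied_mem hG ha lam) _
  simp only [update, gradEst, h]
  rfl

/-- Intended and applied actions never leave the action space, so the algorithm evaluates the
utilities only where truncation changes nothing. -/
theorem realized_truncate {Ω : Type*} {a₁ : Ω → Profile d}
    {lam : (i : Fin N) → ℕ → Ω → UnitSphere (d i)} {I : Fin N → ℕ → Ω → Bool}
    (hG : G.IsRegular) (hP : ∀ k, P.IsSafe G k) (ha₁ : ∀ ω, a₁ ω ∈ G.actions) (k : ℕ) (ω : Ω) :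
    realized G.truncate P a₁ lam I k ω = realized G P a₁ lam I k ω := by
  have h : intended G.truncate P a₁ lam I k ω = intended G P a₁ lam I k ω := by
    induction k with
    | zero => rfl
    | succ k ih =>
      simp only [intended]
      rw [ih]
      exact update_truncate hG (hP k) _ _ (intended_mem hG ha₁ k ω)
  simp only [realized, h]

end Convergence

end OGDlb

end

/-! ### Conclusion -/

theorem theorem2 {N : ℕ} {d : Fin N → ℕ} (G : OGDlb.Game d)
    (hG : G.IsRegular) (hmono : G.IsStrictlyMonotone)
    -- safety balls
    (c : OGDlb.Profile d) (r : Fin N → ℝ)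
    (hball : ∀ i, Metric.closedBall (c i) (r i) ⊆ G.A i)
    -- step sizes and query radii
    (γ δ : ℕ → ℝ) (hγ_pos : ∀ k, 0 < γ k) (hδ_pos : ∀ k, 0 < δ k) (hδ_anti : Antitone δ)
    (hδ_r : ∀ i, δ 0 < r i)
    (hγ_lim : Tendsto γ atTop (𝓝 0)) (hδ_lim : Tendsto δ atTop (𝓝 0))
    (hγ_sum : Tendsto (fun n => ∑ k ∈ Finset.range n, γ k) atTop atTop)
    (hγδ_sum : Summable (fun k => γ k * δ k))
    (hγδ_sq_sum : Summable (fun k => γ k ^ 2 / δ k ^ 2))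
    -- randomness
    {Ω : Type*} [MeasurableSpace Ω] (μ : Measure Ω) [IsProbabilityMeasure μ]
    (p : Fin N → ℝ) (hp : ∀ i, 0 < p i)
    (a₁ : Ω → OGDlb.Profile d) (ha₁ : ∀ ω, a₁ ω ∈ G.actions)
    (lam : (i : Fin N) → ℕ → Ω → OGDlb.UnitSphere (d i)) (I : Fin N → ℕ → Ω → Bool)
    (hsamp : OGDlb.IsSampling a₁ lam I μ p) :
    ∃ aStar : OGDlb.Profile d,
      G.IsNash aStar ∧ (∀ b, G.IsNash b → b = aStar) ∧
      ∀ᵐ ω ∂μ, Tendsto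
        (fun k => OGDlb.realized G
          { c := c, r := r, δ := δ, step := fun i k => γ k / p i } a₁ lam I k ω)
        atTop (𝓝 aStar) := by

  obtain ⟨b, hb⟩ := hG.exists_isNash hmono
  set P : OGDlb.Params d := { c := c, r := r, δ := δ, step := fun i k => γ k / p i }
  -- Stages start at `0`, so monotonicity of `δ` carries `δ 0 < r i` to every stage.
  have hP : ∀ k, P.IsSafe G k := fun k =>
    ⟨hball, hδ_pos k, fun i => (hδ_anti (Nat.zero_le k)).trans_lt (hδ_r i)⟩
  refine ⟨b, hb, fun b' hb' => hG.isNash_unique hmono hb' hb, ?_⟩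
  have h := hsamp.ae_tendsto_realized (G := G.truncate) hG.truncate hmono.truncate
    hG.measurable_truncate P (fun k => ⟨hball, (hP k).pos, (hP k).lt_radius⟩) hp hγ_pos
    (fun _ _ => rfl) hδ_lim hγ_sum hγδ_sum hγδ_sq_sum ha₁ hb.truncate
  simpa only [OGDlb.realized_truncate hG hP ha₁] using h
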